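/- Let $m,n\ge 0$ be integers, let $U\subset\mathbb{R}^{m+n}$ be an open Euclidean ball of positive radius, and let $E$ be a continuous tangent subbundle of rank $m$ on $U$, i.e. a choice of $m$-dimensional linear subspaces $E_p\subset T_pU=\mathbb{R}^{m+n}$, $p\in U$, that is locally spanned by $m$ linearly independent continuous vector fields. A *local integral manifold* of $E$ is an (embedded) $C^1$ submanifold $N\subset U$ with $T_pN=E_p$ for every $p\in N$. The subbundle $E$ is *integrable* if there is a local integral manifold through every point of $U$. It is *uniquely integrable* if it is integrable and, for any two integral manifolds $N_1,N_2$, the intersection $N_1\cap N_2$ is relatively open in both $N_1$ and $N_2$. Let $\mathcal{A}^1(E)$ be the space of continuous $1$-forms $\eta$ on $U$ with $E\subset\ker\eta$; a *basis* of $\mathcal{A}^1(E)$ is a family of $n$ elements that are linearly independent at every point of $U$. For a $k$-form $\omega$ on $U$ let $|\omega|_\infty=\sup_{p\in U}|\omega_p|\in[0,\infty]$, where $|\cdot|$ is the Euclidean norm on $k$-forms, for which the forms $dx_{i_1}\wedge\dots\wedge dx_{i_k}$ ($i_1<\dots<i_k$) are orthonormal. (Conventions: $e^{\infty}=\infty$,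 $0\cdot\infty=0$, and a maximum over the empty set is $0$.) The subbundle $E$ is *strongly asymptotically involutive* if there are a basis $\eta_1,\dots,\eta_n$ of $\mathcal{A}^1(E)$, a constant $\epsilon_0>0$ and $C^1$ $1$-forms $\eta^k_1,\dots,\eta^k_n$ on $U$ ($k\in\mathbb{N}$) such that, as $k\to\infty$, $\max_i|\eta^k_i-\eta_i|_\infty\to0$ and $$\max_j\bigl|\eta^k_1\wedge\dots\wedge\eta^k_n\wedge d\eta^k_j\bigr|_\infty\; e^{\epsilon_0\max_i|d\eta^k_i|_\infty}\longrightarrow 0 .$$ The subbundle $E$ is *strongly exterior regular* if there are a basis $\beta_1,\dots,\beta_n$ of $\mathcal{A}^1(E)$, a constant $\epsilon_1>0$ and $C^1$ $1$-forms $\beta^k_1,\dots,\beta^k_n$ on $U$ ($k\in\mathbb{N}$) such that, as $k\to\infty$, $$\max_j|\beta^k_j-\beta_j|_\infty\; e^{\epsilon_1\max_i|d\beta^k_i|_\infty}\longrightarrow 0 .$$ Theorem. (1) If $E$ is strongly asymptotically involutive, then $E$ is integrable. (2) If $E$ is integrable and strongly exterior regular, then $E$ is uniquely integrable. -/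

import Mathlib

open Set Filter Topology
open scoped ENNReal

namespace ContinuousFrobenius

/-- The Euclidean space `ℝ^d`, canonically identified with each of its tangent spaces. -/
abbrev Euc (d : ℕ) : Type := EuclideanSpace ℝ (Fin d)

/-! ### Submanifolds, distributions and integral manifolds -/

/-- `φ`, restricted to the open set `W ⊆ ℝ^m`, is a `C^1` parametrization of the set `N` near
the point `p`: an injective immersion of class `C^1` which is a homeomorphism of `W` onto the
relatively open piece `N ∩ O` of `N`, where `O` is an open neighbourhood of `p`. -/
structure IsC1Parametrization {d m : ℕ} (N : Set (Euc d)) (p : Euc d)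
    (W : Set (Euc m)) (φ : Euc m → Euc d) (O : Set (Euc d)) : Prop where
  isOpen_source : IsOpen W
  isOpen_target : IsOpen O
  mem_target : p ∈ O
  contDiffOn : ContDiffOn ℝ 1 φ W
  immersion : ∀ w ∈ W, Function.Injective (fderiv ℝ φ w)
  isEmbedding : Topology.IsEmbedding (W.domRestrict φ)
  image_eq : φ '' W = N ∩ O

/-- `N` is an (embedded) `m`-dimensional `C^1` submanifold of `ℝ^d`. -/
def IsC1Submanifold {d : ℕ} (m : ℕ) (N : Set (Euc d)) : Prop :=
  ∀ p ∈ N, ∃ (W : Set (Euc m)) (φ : Euc m → Euc d) (O : Set (Euc d)),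
    IsC1Parametrization N p W φ O

/-- The set `T_p N` of tangent vectors of `N` at `p`: the velocities at time `0` of the curves
that lie in `N` (for small times) and pass through `p` at time `0`. -/
def tangentVectors {d : ℕ} (N : Set (Euc d)) (p : Euc d) : Set (Euc d) :=
  {v | ∃ γ : ℝ → Euc d, γ 0 = p ∧ (∀ᶠ t in 𝓝 0, γ t ∈ N) ∧ HasDerivAt γ v 0}

/-- `E` is a continuous tangent subbundle of rank `m` on the open set `U ⊆ ℝ^d`: a choice of
`m`-dimensional linear subspaces `E x ⊆ T_x U = ℝ^d` for `x ∈ U` which near every point is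
spanned by `m` linearly independent continuous vector fields. -/
def IsContinuousSubbundle {d : ℕ} (m : ℕ) (U : Set (Euc d))
    (E : Euc d → Submodule ℝ (Euc d)) : Prop :=
  ∀ p ∈ U, ∃ O : Set (Euc d), IsOpen O ∧ p ∈ O ∧ ∃ X : Fin m → Euc d → Euc d,
    (∀ i, ContinuousOn (X i) (U ∩ O)) ∧
    ∀ x ∈ U ∩ O, LinearIndependent ℝ (fun i => X i x) ∧
      Submodule.span ℝ (range fun i => X i x) = E x

/-- `N ⊆ U` is a local integral manifold of the rank `m` subbundle `E` on `U`: a `C^1`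
submanifold with `T_p N = E_p` at each of its points. -/
def IsIntegralManifold {d : ℕ} (m : ℕ) (U : Set (Euc d))
    (E : Euc d → Submodule ℝ (Euc d)) (N : Set (Euc d)) : Prop :=
  N ⊆ U ∧ IsC1Submanifold m N ∧ ∀ p ∈ N, tangentVectors N p = (E p : Set (Euc d))

/-- `E` is integrable on `U`: there is a local integral manifold through every point of `U`. -/
def IsIntegrable {d : ℕ} (m : ℕ) (U : Set (Euc d))
    (E : Euc d → Submodule ℝ (Euc d)) : Prop :=
  ∀ p ∈ U, ∃ N : Set (Euc d), p ∈ N ∧ IsIntegralManifold m U E N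

/-- `E` is uniquely integrable on `U`: it is integrable, and the intersection of any two integral
manifolds is relatively open in both of them. -/
def IsUniquelyIntegrable {d : ℕ} (m : ℕ) (U : Set (Euc d))
    (E : Euc d → Submodule ℝ (Euc d)) : Prop :=
  IsIntegrable m U E ∧
    ∀ N₁ N₂ : Set (Euc d), IsIntegralManifold m U E N₁ → IsIntegralManifold m U E N₂ →
      IsOpen ((↑) ⁻¹' N₂ : Set N₁) ∧ IsOpen ((↑) ⁻¹' N₁ : Set N₂)

/-! ### Differential forms -/

/-- A (not necessarily regular) differential `k`-form on `ℝ^d`. -/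
abbrev DiffForm (d k : ℕ) : Type := Euc d → (Euc d) [⋀^Fin k]→L[ℝ] ℝ

/-- The wedge product of two alternating forms, normalized by summing over shuffles
(`(dx ∧ dy)(e₁, e₂) = 1`). -/
noncomputable def wedge {d k l : ℕ} (α : (Euc d) [⋀^Fin k]→ₗ[ℝ] ℝ)
    (β : (Euc d) [⋀^Fin l]→ₗ[ℝ] ℝ) : (Euc d) [⋀^Fin (k + l)]→ₗ[ℝ] ℝ :=
  ((LinearMap.mul' ℝ ℝ).compAlternatingMap (α.domCoprod β)).domDomCongr finSumFinEquiv

/-- The wedge product `η₁ ∧ ⋯ ∧ ηₙ` of a family of `n` alternating `1`-forms. -/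
noncomputable def wedgeAll {d : ℕ} :
    (n : ℕ) → (Fin n → (Euc d) [⋀^Fin 1]→ₗ[ℝ] ℝ) → (Euc d) [⋀^Fin n]→ₗ[ℝ] ℝ
  | 0, _ => AlternatingMap.constOfIsEmpty ℝ (Euc d) (Fin 0) 1
  | n + 1, η => wedge (wedgeAll n fun i => η i.castSucc) (η (Fin.last n))

/-- The Euclidean norm of an alternating `k`-form on `ℝ^d`, for which the forms
`dx_{i₁} ∧ ⋯ ∧ dx_{iₖ}`, `i₁ < ⋯ < iₖ`, are orthonormal. -/
noncomputable def formNorm {d k : ℕ} (α : (Euc d) [⋀^Fin k]→ₗ[ℝ] ℝ) : ℝ :=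
  √(∑ e : Fin k ↪o Fin d, (α fun a => EuclideanSpace.single (e a) (1 : ℝ)) ^ 2)

/-- The sup-norm over `U` of a field of alternating `k`-forms, with values in `[0, ∞]`. -/
noncomputable def formSupNorm {d k : ℕ} (U : Set (Euc d))
    (ω : Euc d → (Euc d) [⋀^Fin k]→ₗ[ℝ] ℝ) : ℝ≥0∞ :=
  ⨆ x ∈ U, ENNReal.ofReal (formNorm (ω x))

/-- `|α - β|_∞`, the sup-norm distance over `U` of two differential forms. -/
noncomputable def supDist {d k : ℕ} (U : Set (Euc d)) (α β : DiffForm d k) : ℝ≥0∞ :=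
  formSupNorm U fun x => (α x - β x).toAlternatingMap

/-- `|dη|_∞`, the sup-norm over `U` of the exterior derivative of the form `η`. -/
noncomputable def supNormD {d k : ℕ} (U : Set (Euc d)) (η : DiffForm d k) : ℝ≥0∞ :=
  formSupNorm U fun x => (extDeriv η x).toAlternatingMap

/-- `|η₁ ∧ ⋯ ∧ ηₙ ∧ dη_j|_∞`, the sup-norm over `U` of the `(n+2)`-form that measures the
failure of involutivity. -/
noncomputable def involutivityDefect {d n : ℕ} (U : Set (Euc d)) (η : Fin n → DiffForm d 1)
    (j : Fin n) : ℝ≥0∞ :=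
  formSupNorm U fun x =>
    wedge (wedgeAll n fun i => (η i x).toAlternatingMap) (extDeriv (η j) x).toAlternatingMap

/-- The factor `exp (ε * s)` for `ε : ℝ` positive and `s ∈ [0, ∞]`; it is `∞` for `s = ∞`. -/
noncomputable def expFactor (ε : ℝ) (s : ℝ≥0∞) : ℝ≥0∞ :=
  EReal.exp ((ENNReal.ofReal ε * s : ℝ≥0∞) : EReal)

/-- `η₁, …, ηₙ` is a basis of the space `𝒜¹(E)` of the (continuous) `1`-forms on `U` that
annihilate `E`. For `E` of corank `n` this means `n` pointwise linearly independent `1`-forms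
which vanish on `E`. -/
def IsAnnihilatorBasis {d n : ℕ} (U : Set (Euc d)) (E : Euc d → Submodule ℝ (Euc d))
    (η : Fin n → DiffForm d 1) : Prop :=
  (∀ i, ContinuousOn (η i) U) ∧
  (∀ i, ∀ x ∈ U, ∀ v ∈ E x, η i x (fun _ => v) = 0) ∧
  ∀ x ∈ U, LinearIndependent ℝ (fun i => η i x)

/-- Strong asymptotic involutivity of a subbundle `E` of corank `n` on `U`. -/
def StronglyAsymptoticallyInvolutive {d : ℕ} (n : ℕ) (U : Set (Euc d))
    (E : Euc d → Submodule ℝ (Euc d)) : Prop :=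
  ∃ (η : Fin n → DiffForm d 1) (ε₀ : ℝ) (ηs : ℕ → Fin n → DiffForm d 1),
    IsAnnihilatorBasis U E η ∧ 0 < ε₀ ∧ (∀ k i, ContDiffOn ℝ 1 (ηs k i) U) ∧
    Tendsto (fun k => ⨆ i, supDist U (ηs k i) (η i)) atTop (𝓝 0) ∧
    Tendsto (fun k => (⨆ j, involutivityDefect U (ηs k) j) *
      expFactor ε₀ (⨆ i, supNormD U (ηs k i))) atTop (𝓝 0)

/-- Strong exterior regularity of a subbundle `E` of corank `n` on `U`. -/
def StronglyExteriorRegular {d : ℕ} (n : ℕ) (U : Set (Euc d))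
    (E : Euc d → Submodule ℝ (Euc d)) : Prop :=
  ∃ (β : Fin n → DiffForm d 1) (ε₁ : ℝ) (βs : ℕ → Fin n → DiffForm d 1),
    IsAnnihilatorBasis U E β ∧ 0 < ε₁ ∧ (∀ k i, ContDiffOn ℝ 1 (βs k i) U) ∧
    Tendsto (fun k => (⨆ j, supDist U (βs k j) (β j)) *
      expFactor ε₁ (⨆ i, supNormD U (βs k i))) atTop (𝓝 0)

end ContinuousFrobenius

/-!
Both parts are local, so one works near a point `p`, in an affine chart `ℝ^d ≅ P × Q` with
`P = ℝ^m` and `Q = ℝ^n`, in which the basis of the annihilator becomes a `Q`-valued `1`-form `θ`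
that is close to the projection to `Q` (`exists_adapted_chart`). Kernels of such forms are graphs
of linear maps `a(z) : P → Q` (`graphSlope`). The approximating forms `θₖ` have the same property,
with slopes `aₖ`; write `M` for a bound of `dθₖ`. The chart may be as small as one wishes compared
with the constant `ε` of the hypothesis, so that a Grönwall factor `exp (C M)`, with `C` the size
of the chart, is absorbed by the factor `exp (ε M)`. On a compact ball `dθₖ` is always bounded;
this takes care of suprema which are infinite (`exists_real_exp_bound`).

Integrability. Solve `g' = aₖ(s x, g) x`, `g(0) = 0`, along the rays of `P` and put `fₖ(x) = g(1)`.
To see that the graph of `fₖ` is almost tangent to `ker θₖ`, compare the solutions `g`, `ĝ` with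
endpoints `x`, `x + h`: for `v(s) = ĝ - g - s aₖ h`, the vector `w = θₖ(0, v)` satisfies, up to
`o(h)`, `w' = dθₖ((x, aₖ x), (0, v)) + s dθₖ((x, aₖ x), (h, aₖ h))`. The derivatives of `aₖ`, on
which there is no control, have disappeared; the first term is at most a multiple of `M ‖w‖`, and
the second is small because `dθₖ` almost vanishes on `ker θₖ`, which is what the form
`η₁ ∧ ⋯ ∧ ηₙ ∧ dη_j` measures (`norm_curl_le_of_involutivityDefect`). Grönwall's inequality gives
`eventually_radial_estimate`, and neither the differentiability of the flow nor that of `fₖ` is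
needed. A mean value inequality for such almost differentiable maps shows that a pointwise limit
`f` of the `fₖ` along an ultrafilter has derivative `a(x, f x)` (`exists_integral_graph`), and the
graph of `f` is an integral manifold.

Unique integrability. Let `γ₁`, `γ₂` be curves tangent to `ker θ`, with the same projection to `P`
and the same starting point. By Stokes' theorem on the strip of segments from `γ₁ s` to `γ₂ s`, the
integral of `θₖ` over such a segment grows at most by `M ‖γ₂ - γ₁‖` and by the values of `θₖ - θ` on
the velocities, while it is comparable to `γ₂ - γ₁`. Grönwall's inequality yields `γ₁ = γ₂`
(`eq_of_tangent_curves`). A point of `N₁` near `p ∈ N₁ ∩ N₂` is joined to `p` by a short curve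
`γ₁` in `N₁`; by the inverse function theorem `N₂` has a local section over `P`, which lifts the
projection of `γ₁` to a curve `γ₂` in `N₂`, so the endpoint of `γ₁` lies in `N₂`.
-/

namespace ContinuousFrobenius

/-! ### Wedge products of one-forms and the Euclidean norm of a form -/

lemma wedge_apply_append {d k l : ℕ} (α : (Euc d) [⋀^Fin k]→ₗ[ℝ] ℝ)
    (β : (Euc d) [⋀^Fin l]→ₗ[ℝ] ℝ) (Y : Fin k → Euc d) (X : Fin l → Euc d)
    (h : ∀ v : Fin k → Euc d, (∃ i j, v i = X j) → α v = 0) :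
    wedge α β (Fin.append Y X) = α Y * β X := by
  classical
  have hv : (Fin.append Y X) ∘ (finSumFinEquiv : Fin k ⊕ Fin l ≃ Fin (k + l)) = Sum.elim Y X := by
    ext i
    rcases i with i | i <;> simp
  have h1 : wedge α β (Fin.append Y X)
      = LinearMap.mul' ℝ ℝ ((α.domCoprod β) (Sum.elim Y X)) := by
    rw [← hv]; rfl
  rw [h1, AlternatingMap.domCoprod_apply, _root_.sum_apply, map_sum]
  refine (Finset.sum_eq_single
    (Quotient.mk'' 1 : Equiv.Perm.ModSumCongr (Fin k) (Fin l)) ?_ ?_).trans ?_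
  · intro σ _ hσ
    induction σ using Quotient.inductionOn' with | _ σ
    rw [AlternatingMap.domCoprod.summand_mk'']
    have hex : ∃ i j, σ (Sum.inl i) = Sum.inr j := by
      by_contra hcon
      push Not at hcon
      apply hσ
      refine Quotient.sound' ?_
      rw [QuotientGroup.leftRel_apply]
      refine Equiv.Perm.mem_sumCongrHom_range_of_perm_mapsTo_inl ?_
      have hm : MapsTo σ (range Sum.inl) (range Sum.inl) := by
        rintro _ ⟨i, rfl⟩
        rcases hs : σ (Sum.inl i) with a | b
        · exact ⟨a, rfl⟩
        · exact absurd hs (hcon i b)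
      rintro _ ⟨i, rfl⟩
      have hfin : σ '' (range Sum.inl) = range Sum.inl :=
        Set.eq_of_subset_of_ncard_le hm.image_subset
          (by rw [Set.ncard_image_of_injective _ σ.injective]) (Set.toFinite _)
      have : (Sum.inl i : Fin k ⊕ Fin l) ∈ σ '' (range Sum.inl) := by rw [hfin]; exact ⟨i, rfl⟩
      obtain ⟨y, hy, hyi⟩ := this
      simp only [mul_one]
      rw [← hyi]
      simpa using hy
    obtain ⟨i, j, hij⟩ := hex
    have h0 : α (fun i => Sum.elim Y X (σ (Sum.inl i))) = 0 := h _ ⟨i, j, by simp [hij]⟩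
    simp [MultilinearMap.domCoprod_apply, h0]
  · simp
  · rw [AlternatingMap.domCoprod.summand_mk'']
    simp [MultilinearMap.domCoprod_apply]

lemma wedgeAll_eq_zero {d n : ℕ} (η : Fin n → (Euc d) [⋀^Fin 1]→ₗ[ℝ] ℝ) (v : Fin n → Euc d)
    (j : Fin n) (hj : ∀ i, η i (fun _ => v j) = 0) : wedgeAll n η v = 0 := by
  classical
  induction n with
  | zero => exact j.elim0
  | succ n ih =>
    have h1 : wedgeAll (n + 1) η v = LinearMap.mul' ℝ ℝ
        (((wedgeAll n fun i => η i.castSucc).domCoprod (η (Fin.last n))) (v ∘ finSumFinEquiv)) :=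
      rfl
    rw [h1, AlternatingMap.domCoprod_apply, _root_.sum_apply, map_sum]
    refine Finset.sum_eq_zero fun σ _ => ?_
    induction σ using Quotient.inductionOn' with | _ σ
    rw [AlternatingMap.domCoprod.summand_mk'']
    have key : (wedgeAll n fun i => η i.castSucc)
          (fun i => v (finSumFinEquiv (σ (Sum.inl i)))) = 0 ∨
        η (Fin.last n) (fun i => v (finSumFinEquiv (σ (Sum.inr i)))) = 0 := by
      rcases hs : σ.symm (finSumFinEquiv.symm j) with a | b
      · left
        refine ih _ _ a fun i => ?_
        have : finSumFinEquiv (σ (Sum.inl a)) = j := by rw [← hs]; simp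
        rw [this]; exact hj _
      · right
        have : finSumFinEquiv (σ (Sum.inr b)) = j := by rw [← hs]; simp
        have hfun : (fun i => v (finSumFinEquiv (σ (Sum.inr i)))) = fun _ => v j := by
          ext1 i
          rw [Subsingleton.elim i b, this]
        rw [hfun]; exact hj _
    rcases key with key | key <;> simp [MultilinearMap.domCoprod_apply, key]

lemma wedgeAll_apply_dual {d n : ℕ} (η : Fin n → (Euc d) [⋀^Fin 1]→ₗ[ℝ] ℝ) (Y : Fin n → Euc d)
    (h : ∀ i j, η i (fun _ => Y j) = if i = j then 1 else 0) : wedgeAll n η Y = 1 := by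
  induction n with
  | zero => simp [wedgeAll]
  | succ n ih =>
    have hY : Y = Fin.append (fun i : Fin n => Y i.castSucc) (fun _ : Fin 1 => Y (Fin.last n)) := by
      ext1 i
      refine Fin.lastCases ?_ (fun i => ?_) i
      · exact (Fin.append_right (fun i : Fin n => Y i.castSucc)
          (fun _ : Fin 1 => Y (Fin.last n)) 0).symm
      · exact (Fin.append_left (fun i : Fin n => Y i.castSucc)
          (fun _ : Fin 1 => Y (Fin.last n)) i).symm
    rw [wedgeAll]
    conv_lhs => rw [hY]
    rw [wedge_apply_append, ih, h]
    · simp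
    · intro i j
      rw [h]; simp
    · rintro v ⟨i, j, hij⟩
      refine wedgeAll_eq_zero _ _ i fun a => ?_
      rw [hij, h, if_neg (Fin.castSucc_lt_last a).ne]

/-- On vectors `X` in the common kernel of the `ηᵢ`, the form `η₁ ∧ ⋯ ∧ ηₙ ∧ β` recovers the
values of `β`, once it is completed by vectors dual to the `ηᵢ`. -/
lemma wedge_wedgeAll_apply {d n l : ℕ} (η : Fin n → (Euc d) [⋀^Fin 1]→ₗ[ℝ] ℝ)
    (β : (Euc d) [⋀^Fin l]→ₗ[ℝ] ℝ) (Y : Fin n → Euc d) (X : Fin l → Euc d)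
    (hY : ∀ i j, η i (fun _ => Y j) = if i = j then 1 else 0)
    (hX : ∀ i j, η i (fun _ => X j) = 0) :
    wedge (wedgeAll n η) β (Fin.append Y X) = β X := by
  rw [wedge_apply_append, wedgeAll_apply_dual η Y hY, one_mul]
  rintro v ⟨i, j, hij⟩
  exact wedgeAll_eq_zero _ _ i fun a => by rw [hij, hX]

lemma formNorm_nonneg {d k : ℕ} (α : (Euc d) [⋀^Fin k]→ₗ[ℝ] ℝ) : 0 ≤ formNorm α :=
  Real.sqrt_nonneg _

lemma abs_apply_basis_le_formNorm {d k : ℕ} (α : (Euc d) [⋀^Fin k]→ₗ[ℝ] ℝ) (r : Fin k → Fin d) :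
    |α fun a => EuclideanSpace.single (r a) (1 : ℝ)| ≤ formNorm α := by
  by_cases hr : Function.Injective r
  · have hs : StrictMono (r ∘ Tuple.sort r) :=
      (Tuple.monotone_sort r).strictMono_of_injective (hr.comp (Tuple.sort r).injective)
    have h1 := α.map_perm (fun a => EuclideanSpace.single (r a) (1 : ℝ)) (Tuple.sort r)
    have h2 : |α fun a => EuclideanSpace.single (r a) (1 : ℝ)|
        = |α fun a => EuclideanSpace.single (OrderEmbedding.ofStrictMono _ hs a) (1 : ℝ)| := by
      have h3 : (fun a => EuclideanSpace.single (OrderEmbedding.ofStrictMono _ hs a) (1 : ℝ))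
        = (fun a => EuclideanSpace.single (r a) (1 : ℝ)) ∘ (Tuple.sort r) := rfl
      rw [h3, h1]
      rcases Int.units_eq_one_or (Equiv.Perm.sign (Tuple.sort r)) with h | h <;> simp [h]
    rw [h2, formNorm]
    apply Real.abs_le_sqrt
    exact Finset.single_le_sum (f := fun e : Fin k ↪o Fin d =>
      (α fun a => EuclideanSpace.single (e a) (1 : ℝ)) ^ 2) (fun _ _ => sq_nonneg _)
      (Finset.mem_univ _)
  · rw [Function.Injective] at hr
    push Not at hr
    obtain ⟨a, b, hab, hne⟩ := hr
    rw [α.map_eq_zero_of_eq _ (by simp [hab]) hne, abs_zero]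
    exact formNorm_nonneg α

lemma abs_apply_le_formNorm {d k : ℕ} (α : (Euc d) [⋀^Fin k]→ₗ[ℝ] ℝ) (v : Fin k → Euc d) :
    |α v| ≤ (d : ℝ) ^ k * formNorm α * ∏ i, ‖v i‖ := by
  have hv : v = fun i => ∑ j : Fin d, v i j • EuclideanSpace.single j (1 : ℝ) := by
    ext1 i
    have := (EuclideanSpace.basisFun (Fin d) ℝ).sum_repr (v i)
    simpa using this.symm
  have h1 : α v = ∑ r : Fin k → Fin d,
      (∏ i, v i (r i)) * α fun a => EuclideanSpace.single (r a) (1 : ℝ) := by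
    have := α.toMultilinearMap.map_sum
      (g := fun i (j : Fin d) => v i j • EuclideanSpace.single j (1 : ℝ))
    simp only [MultilinearMap.map_smul_univ, smul_eq_mul] at this
    conv_lhs => rw [hv]
    exact this
  rw [h1]
  calc |∑ r : Fin k → Fin d, (∏ i, v i (r i)) * α fun a => EuclideanSpace.single (r a) (1 : ℝ)|
      ≤ ∑ r : Fin k → Fin d, (∏ i, ‖v i‖) * formNorm α := by
        refine (Finset.abs_sum_le_sum_abs _ _).trans (Finset.sum_le_sum fun r _ => ?_)
        rw [abs_mul, Finset.abs_prod]
        refine mul_le_mul (Finset.prod_le_prod (fun _ _ => abs_nonneg _) fun i _ => ?_)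
          (abs_apply_basis_le_formNorm α r) (abs_nonneg _)
          (Finset.prod_nonneg fun _ _ => norm_nonneg _)
        exact PiLp.norm_apply_le (v i) (r i)
    _ = (d : ℝ) ^ k * formNorm α * ∏ i, ‖v i‖ := by
        simp; ring

/-! ### Calculus preliminaries -/

/-- A continuous curve whose right difference quotients are asymptotically bounded by `C` is
`C`-Lipschitz; no differentiability is needed. -/
lemma norm_sub_le_of_eventually_slope_le {F : Type*} [NormedAddCommGroup F] {f : ℝ → F} {C : ℝ} (hf : ContinuousOn f (Icc 0 1))
    (h : ∀ x ∈ Ico (0 : ℝ) 1, ∀ᶠ t in 𝓝[>] x, ‖f t - f x‖ ≤ C * (t - x)) :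
    ‖f 1 - f 0‖ ≤ C := by
  have key := image_le_of_liminf_slope_right_le_deriv_boundary (f := fun t => ‖f t - f 0‖)
    (a := 0) (b := 1) (B := fun t => C * t) (B' := fun _ => C)
    (by fun_prop) (by simp) (by fun_prop)
    (fun x _ => by simpa using ((hasDerivWithinAt_id x (Ici x)).const_mul C))
    (fun x hx r hr => by
      refine Eventually.frequently ?_
      filter_upwards [h x hx, self_mem_nhdsWithin] with t ht htx
      have htx : 0 < t - x := sub_pos.2 htx
      rw [slope_def_field, div_lt_iff₀ htx]
      have h1 : ‖f t - f 0‖ ≤ ‖f t - f x‖ + ‖f x - f 0‖ := by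
        simpa using norm_add_le (f t - f x) (f x - f 0)
      nlinarith)
    (x := 1) (by simp)
  simpa using key

section Calculus

variable {V F : Type*} [NormedAddCommGroup V] [NormedSpace ℝ V]
  [NormedAddCommGroup F] [NormedSpace ℝ F]

lemma norm_le_mul_exp_of_norm_deriv_right_le {f f' : ℝ → F} {K ε : ℝ} (hK : 0 ≤ K) (hε : 0 ≤ ε)
    (hf : ContinuousOn f (Icc 0 1)) (hf' : ∀ x ∈ Ico (0 : ℝ) 1, HasDerivWithinAt f (f' x) (Ici x) x)
    (h0 : f 0 = 0) (bound : ∀ x ∈ Ico (0 : ℝ) 1, ‖f' x‖ ≤ K * ‖f x‖ + ε) :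
    ∀ x ∈ Icc (0 : ℝ) 1, ‖f x‖ ≤ ε * Real.exp K := by
  intro x hx
  have h := norm_le_gronwallBound_of_norm_deriv_right_le hf hf' (by simp [h0] : ‖f 0‖ ≤ 0)
    bound x hx
  refine h.trans ?_
  rw [sub_zero]
  have hexp : 1 ≤ Real.exp K := Real.one_le_exp hK
  rcases eq_or_lt_of_le hK with rfl | hK
  · rw [gronwallBound_K0]
    simp only [zero_add, Real.exp_zero]
    nlinarith [hx.1, hx.2]
  · rw [gronwallBound_of_K_ne_0 hK.ne']
    have h1 : Real.exp (K * x) ≤ Real.exp K := Real.exp_le_exp.2 (by nlinarith [hx.1, hx.2])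
    have h2 : Real.exp K - 1 ≤ K * Real.exp K := by
      have h3 := Real.add_one_le_exp (-K)
      have h4 : Real.exp (-K) * Real.exp K = 1 := by rw [← Real.exp_add]; simp
      nlinarith [Real.exp_pos K]
    simp only [zero_mul, zero_add]
    rw [div_mul_eq_mul_div, div_le_iff₀ hK]
    nlinarith

/-- On a compact convex set, the first-order Taylor expansion of a `C¹` map is uniform. -/
lemma exists_uniform_taylor {f : V → F} {U K : Set V} (hU : IsOpen U) (hf : ContDiffOn ℝ 1 f U)
    (hK : IsCompact K) (hc : Convex ℝ K) (hKU : K ⊆ U) :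
    (∃ L : ℝ, 0 ≤ L ∧ ∀ z ∈ K, ‖fderiv ℝ f z‖ ≤ L) ∧
    ∀ ε > 0, ∃ η > 0, ∀ z ∈ K, ∀ z' ∈ K, ‖z' - z‖ < η →
      ‖f z' - f z - fderiv ℝ f z (z' - z)‖ ≤ ε * ‖z' - z‖ := by
  have hcont : ContinuousOn (fderiv ℝ f) K :=
    (hf.continuousOn_fderiv_of_isOpen hU le_rfl).mono hKU
  constructor
  · obtain ⟨L, hL⟩ := hK.exists_bound_of_continuousOn hcont
    exact ⟨max L 0, le_max_right _ _, fun z hz => (hL z hz).trans (le_max_left _ _)⟩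
  · intro ε hε
    obtain ⟨η, hη, h⟩ := Metric.uniformContinuousOn_iff.1
      (hK.uniformContinuousOn_of_continuous hcont) ε hε
    refine ⟨η, hη, fun z hz z' hz' hzz => ?_⟩
    have hseg : segment ℝ z z' ⊆ K := hc.segment_subset hz hz'
    refine Convex.norm_image_sub_le_of_norm_hasFDerivWithin_le' (s := segment ℝ z z')
      (f' := fderiv ℝ f) (fun w hw => ?_) (fun w hw => ?_) (convex_segment z z')
      (left_mem_segment ℝ z z') (right_mem_segment ℝ z z')
    · exact ((hf.differentiableOn one_ne_zero).differentiableAt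
        (hU.mem_nhds (hKU (hseg hw)))).hasFDerivAt.hasFDerivWithinAt
    · rw [← dist_eq_norm]
      refine (h w (hseg hw) z hz ?_).le
      refine lt_of_le_of_lt ?_ hzz
      rw [← dist_eq_norm, dist_comm z' z]
      obtain ⟨a, b, ha, hb, hab, rfl⟩ := hw
      rw [dist_eq_norm, dist_eq_norm]
      have : a • z + b • z' - z = b • (z' - z) := by
        rw [← eq_sub_iff_add_eq] at hab; rw [hab]; module
      rw [this, norm_smul, Real.norm_of_nonneg hb, norm_sub_rev z z']
      nlinarith [norm_nonneg (z' - z)]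

/-- The exterior derivative of a vector-valued `1`-form `θ`, as a bilinear expression. -/
noncomputable def curl (θ : V → (V →L[ℝ] F)) (z u v : V) : F :=
  fderiv ℝ θ z u v - fderiv ℝ θ z v u

end Calculus

/-! ### Vector-valued one-forms close to a projection -/

section Slope

variable {P Q : Type*} [NormedAddCommGroup P] [NormedSpace ℝ P]
  [NormedAddCommGroup Q] [NormedSpace ℝ Q]

section

variable {T : P × Q →L[ℝ] Q}

lemma norm_le_two_mul_of_near_snd (hT : ‖T - ContinuousLinearMap.snd ℝ P Q‖ ≤ 1 / 2) (v : Q) :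
    ‖v‖ ≤ 2 * ‖T (0, v)‖ := by
  have h1 := (T - ContinuousLinearMap.snd ℝ P Q).le_of_opNorm_le hT (0, v)
  have h2 : ‖((0 : P), v)‖ = ‖v‖ := by simp [Prod.norm_def]
  have h3 : ‖v‖ ≤ ‖T (0, v)‖ + ‖(T - ContinuousLinearMap.snd ℝ P Q) (0, v)‖ := by
    have := norm_sub_le (T (0, v)) ((T - ContinuousLinearMap.snd ℝ P Q) (0, v))
    simpa using this
  rw [h2] at h1
  linarith

lemma norm_snd_le_of_near_snd (hT : ‖T - ContinuousLinearMap.snd ℝ P Q‖ ≤ 1 / 2) {w : P × Q}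
    (hw : T w = 0) : ‖w.2‖ ≤ ‖w.1‖ := by
  have h1 := (T - ContinuousLinearMap.snd ℝ P Q).le_of_opNorm_le hT w
  simp only [sub_apply, hw, ContinuousLinearMap.coe_snd', zero_sub, norm_neg] at h1
  by_contra hcon
  push Not at hcon
  rw [Prod.norm_def, max_eq_right hcon.le] at h1
  linarith [norm_nonneg w.1]

lemma norm_eq_of_near_snd (hT : ‖T - ContinuousLinearMap.snd ℝ P Q‖ ≤ 1 / 2) {w : P × Q}
    (hw : T w = 0) : ‖w‖ = ‖w.1‖ := by
  rw [Prod.norm_def, max_eq_left (norm_snd_le_of_near_snd hT hw)]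

lemma norm_le_two_of_near_snd (hT : ‖T - ContinuousLinearMap.snd ℝ P Q‖ ≤ 1 / 2) : ‖T‖ ≤ 2 := by
  have h1 : ‖T‖ ≤ ‖T - ContinuousLinearMap.snd ℝ P Q‖ + ‖ContinuousLinearMap.snd ℝ P Q‖ := by
    simpa using norm_add_le (T - ContinuousLinearMap.snd ℝ P Q) (ContinuousLinearMap.snd ℝ P Q)
  linarith [ContinuousLinearMap.norm_snd_le ℝ P Q]

end

/-- The linear map `P → Q` whose graph is the kernel of `T : P × Q → Q`, provided that `T` is
invertible on `Q`. -/
noncomputable def graphSlope (T : P × Q →L[ℝ] Q) : P →L[ℝ] Q :=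
  -((T ∘L ContinuousLinearMap.inr ℝ P Q).inverse ∘L (T ∘L ContinuousLinearMap.inl ℝ P Q))

variable [FiniteDimensional ℝ Q] {T T' : P × Q →L[ℝ] Q}

lemma isInvertible_of_near_snd (hT : ‖T - ContinuousLinearMap.snd ℝ P Q‖ ≤ 1 / 2) :
    (T ∘L ContinuousLinearMap.inr ℝ P Q).IsInvertible := by
  have hinj : Function.Injective (T ∘L ContinuousLinearMap.inr ℝ P Q : Q →ₗ[ℝ] Q) := by
    rw [← LinearMap.ker_eq_bot, LinearMap.ker_eq_bot']
    intro v hv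
    have h := norm_le_two_mul_of_near_snd hT v
    have : T (0, v) = 0 := hv
    rw [this] at h
    simpa using h
  refine ⟨(LinearEquiv.ofInjectiveEndo _ hinj).toContinuousLinearEquiv, ?_⟩
  ext v
  rfl

lemma exists_apply_inr_eq (hT : ‖T - ContinuousLinearMap.snd ℝ P Q‖ ≤ 1 / 2) (q : Q) :
    ∃ y : Q, T (0, y) = q ∧ ‖y‖ ≤ 2 * ‖q‖ := by
  obtain ⟨e, he⟩ := isInvertible_of_near_snd hT
  have h1 : T (0, e.symm q) = q := by
    have h2 : (e : Q →L[ℝ] Q) (e.symm q) = q := e.apply_symm_apply q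
    rwa [he] at h2
  have h3 := norm_le_two_mul_of_near_snd hT (e.symm q)
  rw [h1] at h3
  exact ⟨e.symm q, h1, h3⟩

lemma apply_graphSlope (hT : ‖T - ContinuousLinearMap.snd ℝ P Q‖ ≤ 1 / 2) (ξ : P) :
    T (ξ, graphSlope T ξ) = 0 := by
  obtain ⟨e, he⟩ := isInvertible_of_near_snd hT
  have h1 : T (ξ, graphSlope T ξ) = T (ξ, 0) + e (graphSlope T ξ) := by
    rw [show e (graphSlope T ξ) = (T ∘L ContinuousLinearMap.inr ℝ P Q) (graphSlope T ξ) by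
      rw [← he]; rfl]
    simp [← map_add]
  rw [h1, graphSlope, ← he]
  simp

lemma norm_graphSlope_apply_le (hT : ‖T - ContinuousLinearMap.snd ℝ P Q‖ ≤ 1 / 2) (ξ : P) :
    ‖graphSlope T ξ‖ ≤ ‖ξ‖ :=
  norm_snd_le_of_near_snd hT (apply_graphSlope hT ξ)

lemma eq_graphSlope_of_apply_eq_zero (hT : ‖T - ContinuousLinearMap.snd ℝ P Q‖ ≤ 1 / 2)
    {w : P × Q} (hw : T w = 0) : w.2 = graphSlope T w.1 := by
  have h := norm_le_two_mul_of_near_snd hT (w.2 - graphSlope T w.1)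
  have h1 : ((0 : P), w.2 - graphSlope T w.1) = w - (w.1, graphSlope T w.1) := by
    ext <;> simp
  rw [h1, map_sub, hw, apply_graphSlope hT, sub_zero, norm_zero, mul_zero] at h
  exact sub_eq_zero.1 (norm_le_zero_iff.1 h)

lemma norm_graphSlope_sub_le (hT : ‖T - ContinuousLinearMap.snd ℝ P Q‖ ≤ 1 / 2)
    (hT' : ‖T' - ContinuousLinearMap.snd ℝ P Q‖ ≤ 1 / 2) :
    ‖graphSlope T - graphSlope T'‖ ≤ 2 * ‖T - T'‖ := by
  refine ContinuousLinearMap.opNorm_le_bound _ (by positivity) fun ξ => ?_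
  refine (norm_le_two_mul_of_near_snd hT _).trans ?_
  have h1 : ((0 : P), (graphSlope T - graphSlope T') ξ)
      = (ξ, graphSlope T ξ) - (ξ, graphSlope T' ξ) := by ext <;> simp
  rw [h1, map_sub, apply_graphSlope hT, zero_sub, norm_neg, mul_assoc]
  have h2 : T (ξ, graphSlope T' ξ) = (T - T') (ξ, graphSlope T' ξ) := by
    rw [sub_apply, apply_graphSlope hT', sub_zero]
  rw [h2]
  have h3 := (T - T').le_opNorm (ξ, graphSlope T' ξ)
  rw [norm_eq_of_near_snd hT' (apply_graphSlope hT' ξ)] at h3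
  linarith

lemma contDiffAt_graphSlope (hT : ‖T - ContinuousLinearMap.snd ℝ P Q‖ ≤ 1 / 2) :
    ContDiffAt ℝ 1 (graphSlope : (P × Q →L[ℝ] Q) → (P →L[ℝ] Q)) T := by
  have : CompleteSpace Q := FiniteDimensional.complete ℝ Q
  have h1 : ContDiffAt ℝ 1
      (fun T : P × Q →L[ℝ] Q => (T ∘L ContinuousLinearMap.inr ℝ P Q).inverse) T :=
    (isInvertible_of_near_snd hT).contDiffAt_map_inverse.comp
      (f := fun T : P × Q →L[ℝ] Q => T ∘L ContinuousLinearMap.inr ℝ P Q) T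
      (contDiff_id.clm_comp contDiff_const).contDiffAt
  exact (h1.clm_comp (contDiff_id.clm_comp contDiff_const).contDiffAt).neg

end Slope

/-! ### Approximate integral manifolds of an approximately involutive smooth form -/

section Approximate

variable {P Q : Type*} [NormedAddCommGroup P] [NormedSpace ℝ P]
  [NormedAddCommGroup Q] [NormedSpace ℝ Q]

/-- If the kernel of `θ` is the graph of `a`, the difference quotients of `a` in the direction of
the graph are controlled by the exterior derivative of `θ`. -/
lemma apply_fderiv_slope {θ : P × Q → (P × Q →L[ℝ] Q)} {a : P × Q → P →L[ℝ] Q} {z : P × Q}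
    (hθ : DifferentiableAt ℝ θ z) (ha : DifferentiableAt ℝ a z)
    (hker : ∀ᶠ z' in 𝓝 z, ∀ ξ, θ z' (ξ, a z' ξ) = 0) (u : P × Q) (ξ : P) :
    θ z (0, fderiv ℝ a z u ξ) = -fderiv ℝ θ z u (ξ, a z ξ) := by
  have h1 : HasFDerivAt (fun z' => θ z' (ξ, a z' ξ)) (0 : P × Q →L[ℝ] Q) z :=
    (hasFDerivAt_const (0 : Q) z).congr_of_eventuallyEq (hker.mono fun z' h => h ξ)
  have h2 := hθ.hasFDerivAt.clm_apply
    ((hasFDerivAt_const ξ z).prodMk (ha.hasFDerivAt.clm_apply (hasFDerivAt_const ξ z)))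
  have h3 := congrArg (fun A : P × Q →L[ℝ] Q => A u) (h1.unique h2)
  simp only [zero_apply, add_apply, ContinuousLinearMap.comp_apply,
    ContinuousLinearMap.flip_apply, ContinuousLinearMap.prod_apply] at h3
  rw [eq_neg_iff_add_eq_zero]
  simpa using h3.symm

variable [FiniteDimensional ℝ Q]

/-- The solution of `g' = a(s x, g) x`, `g(0) = 0`: the radial lift of the segment from `0` to `x`
to a curve tangent to the graphs of `a`. -/
lemma exists_radial_lift {a : P × Q → P →L[ℝ] Q} {ρ L : ℝ} (hρ : 0 < ρ) (hL : 0 ≤ L)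
    (hcont : ContinuousOn a (Metric.closedBall 0 ρ))
    (ha : ∀ z ∈ Metric.closedBall (0 : P × Q) ρ, ∀ ξ, ‖a z ξ‖ ≤ ‖ξ‖)
    (hlip : ∀ z ∈ Metric.closedBall (0 : P × Q) ρ, ∀ z' ∈ Metric.closedBall (0 : P × Q) ρ,
      ‖a z' - a z‖ ≤ L * ‖z' - z‖)
    {x : P} (hx : ‖x‖ ≤ ρ) :
    ∃ g : ℝ → Q, g 0 = 0 ∧ (∀ s ∈ Icc (0 : ℝ) 1, ‖g s‖ ≤ ρ) ∧
      ∀ s ∈ Icc (0 : ℝ) 1, HasDerivWithinAt g (a (s • x, g s) x) (Icc 0 1) s := by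
  have : CompleteSpace Q := FiniteDimensional.complete ℝ Q
  lift ρ to NNReal using hρ.le
  lift L to NNReal using hL
  have hmem : ∀ t ∈ Icc (0 : ℝ) 1, ∀ y ∈ Metric.closedBall (0 : Q) ρ,
      (t • x, y) ∈ Metric.closedBall (0 : P × Q) ρ := by
    intro t ht y hy
    rw [mem_closedBall_zero_iff] at hy ⊢
    refine norm_prod_le_iff.2 ⟨?_, hy⟩
    rw [norm_smul, Real.norm_of_nonneg ht.1]
    nlinarith [ht.2, norm_nonneg x]
  have hPL : IsPicardLindelof (fun t y => a (t • x, y) x) (⟨0, by simp⟩ : Icc (0 : ℝ) 1) (0 : Q)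
      ρ 0 ρ (L * ρ) := by
    refine ⟨fun t ht => ?_, fun y hy => ?_, fun t ht y hy => ?_, ?_⟩
    · refine LipschitzOnWith.of_dist_le_mul fun y hy y' hy' => ?_
      have h := hlip _ (hmem t ht y' hy') _ (hmem t ht y hy)
      rw [dist_eq_norm, dist_eq_norm, ← sub_apply]
      refine ((a (t • x, y) - a (t • x, y')).le_opNorm x).trans ?_
      have h2 : ‖((t • x, y) : P × Q) - (t • x, y')‖ = ‖y - y'‖ := by simp [Prod.norm_def]
      rw [h2] at h
      calc _ ≤ (L * ‖y - y'‖) * ρ := by gcongr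
        _ = _ := by simp; ring
    · have h1 : ContinuousOn (fun t : ℝ => a (t • x, y)) (Icc 0 1) :=
        hcont.comp (by fun_prop) fun t ht => hmem t ht y hy
      exact h1.clm_apply continuousOn_const
    · exact (ha _ (hmem t ht y hy) x).trans hx
    · simp
  obtain ⟨α, hα⟩ := ODE.FunSpace.exists_isFixedPt_next hPL
    (Metric.mem_closedBall_self (by simp) : (0 : Q) ∈ Metric.closedBall (0 : Q) ((0 : NNReal) : ℝ))
  have hmem' : ∀ t : ℝ, α.compProj t ∈ Metric.closedBall (0 : Q) ρ := fun t =>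
    α.compProj_mem_closedBall hPL.mul_max_le
  refine ⟨α.compProj, ?_, fun s _ => by simpa using hmem' s, fun t ht => ?_⟩
  · have h0 : α.compProj 0 = α.toFun ⟨0, by simp⟩ :=
      ODE.FunSpace.compProj_of_mem (by simp : (0 : ℝ) ∈ Icc (0 : ℝ) 1)
    rw [h0, ← hα]
    exact ODE.FunSpace.next_apply₀ hPL _ α
  · apply ODE.hasDerivWithinAt_picard_Icc (f := fun t y => a (t • x, y) x)
      (⟨0, by simp⟩ : Icc (0 : ℝ) 1).2 hPL.continuousOn_uncurry
      α.continuous_compProj.continuousOn (fun _ _ => hmem' _) 0 ht |>.congr_of_mem _ ht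
    intro t' ht'
    nth_rw 1 [← hα]
    rw [ODE.FunSpace.compProj_of_mem ht', ODE.FunSpace.next_apply]

omit [FiniteDimensional ℝ Q] in
/-- The pointwise estimate behind the Grönwall argument of `eventually_radial_estimate`. Here
`A = a(z)`, `B = a(z')`, `D` and `S` are the derivatives of `a` and `θ` at `z`, and `T = θ(z)`;
the increment `z' - z` is `(s h, s A h + v)`. The terms without small factors only involve the
exterior derivative `S u w - S w u`, and the one which is not proportional to `v` involves it only
on the kernel of `T`. -/
lemma norm_deriv_radial_le {A B : P →L[ℝ] Q} {D : P × Q →L[ℝ] (P →L[ℝ] Q)} {T : P × Q →L[ℝ] Q}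
    {S : P × Q →L[ℝ] (P × Q →L[ℝ] Q)} {M δ ε L ρ s : ℝ} {x h : P} {v : Q}
    (hM0 : 0 ≤ M) (hδ0 : 0 ≤ δ) (hε : 0 ≤ ε) (hL : 0 ≤ L)
    (hT : ‖T - ContinuousLinearMap.snd ℝ P Q‖ ≤ 1 / 2) (hA : ∀ ξ, T (ξ, A ξ) = 0)
    (hD : ∀ u ξ, T (0, D u ξ) = -S u (ξ, A ξ))
    (hM : ∀ u w, ‖S u w - S w u‖ ≤ M * ‖u‖ * ‖w‖)
    (hδ : ∀ u w, T u = 0 → T w = 0 → ‖S u w - S w u‖ ≤ δ * ‖u‖ * ‖w‖)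
    (hs : s ∈ Icc (0 : ℝ) 1) (hx : ‖x‖ ≤ ρ) (hh : ‖h‖ ≤ ε)
    (hB : ‖B - A - D (s • h, s • A h + v)‖ ≤ ε * ‖((s • h, s • A h + v) : P × Q)‖)
    (hB' : ‖B - A‖ ≤ L * ‖((s • h, s • A h + v) : P × Q)‖) :
    ‖S (x, A x) (0, v) + T (0, B (x + h) - A x - (A h + s • D (x, A x) h))‖
      ≤ 2 * (M * ρ + 2 * ε * (ρ + L)) * ‖T (0, v)‖ + (δ * ρ + 2 * ε * (ρ + L)) * ‖h‖ := by
  have hρ : 0 ≤ ρ := (norm_nonneg x).trans hx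
  have hv := norm_le_two_mul_of_near_snd hT v
  set Δ : P × Q := (s • h, s • A h + v) with hΔ
  have hgraph : ∀ ξ, ‖((ξ, A ξ) : P × Q)‖ = ‖ξ‖ := fun ξ => norm_eq_of_near_snd hT (hA ξ)
  have hΔle : ‖Δ‖ ≤ ‖h‖ + ‖v‖ := by
    have h1 : Δ = s • (h, A h) + (0, v) := by ext <;> simp [hΔ]
    rw [h1]
    refine (norm_add_le _ _).trans (add_le_add ?_ ?_)
    · rw [norm_smul, hgraph, Real.norm_of_nonneg hs.1]
      nlinarith [hs.2, norm_nonneg h]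
    · simp [Prod.norm_def]
  set r : Q := (B - A - D Δ) x + (B - A) h with hr
  have hr_le : ‖r‖ ≤ ε * (ρ + L) * (‖h‖ + ‖v‖) := by
    calc ‖r‖ ≤ ‖B - A - D Δ‖ * ‖x‖ + ‖B - A‖ * ‖h‖ :=
          (norm_add_le _ _).trans (add_le_add (ContinuousLinearMap.le_opNorm _ _)
            (ContinuousLinearMap.le_opNorm _ _))
      _ ≤ (ε * ‖Δ‖) * ρ + (L * ‖Δ‖) * ε := by gcongr
      _ = ε * (ρ + L) * ‖Δ‖ := by ring
      _ ≤ _ := by gcongr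
  have hsplit : B (x + h) - A x - (A h + s • D (x, A x) h)
      = s • D (h, A h) x + D (0, v) x - s • D (x, A x) h + r := by
    have h1 : D Δ = s • D (h, A h) + D (0, v) := by
      rw [← map_smul, ← map_add]; congr 1; ext <;> simp [hΔ]
    rw [hr, h1]
    simp only [map_add, sub_apply, add_apply, _root_.smul_apply]
    abel
  have hTsplit : S (x, A x) (0, v) + T (0, B (x + h) - A x - (A h + s • D (x, A x) h))
      = (S (x, A x) (0, v) - S (0, v) (x, A x))
        + s • (S (x, A x) (h, A h) - S (h, A h) (x, A x)) + T (0, r) := by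
    have h2 : ((0 : P), s • D (h, A h) x + D (0, v) x - s • D (x, A x) h + r)
        = s • ((0 : P), D (h, A h) x) + (0, D (0, v) x) - s • (0, D (x, A x) h) + (0, r) := by
      ext <;> simp
    rw [hsplit, h2, map_add, map_sub, map_add, map_smul, map_smul, hD, hD, hD]
    module
  rw [hTsplit]
  have e1 : ‖S (x, A x) (0, v) - S (0, v) (x, A x)‖ ≤ M * ρ * ‖v‖ := by
    refine (hM _ _).trans ?_
    rw [hgraph, show ‖((0 : P), v)‖ = ‖v‖ by simp [Prod.norm_def]]
    gcongr
  have e2 : ‖s • (S (x, A x) (h, A h) - S (h, A h) (x, A x))‖ ≤ δ * ρ * ‖h‖ := by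
    have := hδ (x, A x) (h, A h) (hA x) (hA h)
    rw [hgraph, hgraph] at this
    rw [norm_smul, Real.norm_of_nonneg hs.1]
    calc s * _ ≤ 1 * (δ * ρ * ‖h‖) := by
          refine mul_le_mul hs.2 (this.trans ?_) (norm_nonneg _) zero_le_one
          gcongr
      _ = _ := one_mul _
  have e3 : ‖T (0, r)‖ ≤ 2 * (ε * (ρ + L) * (‖h‖ + ‖v‖)) := by
    refine (T.le_of_opNorm_le (norm_le_two_of_near_snd hT) _).trans ?_
    rw [show ‖((0 : P), r)‖ = ‖r‖ by simp [Prod.norm_def]]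
    gcongr
  have e4 : (M * ρ + 2 * ε * (ρ + L)) * ‖v‖ ≤ (M * ρ + 2 * ε * (ρ + L)) * (2 * ‖T (0, v)‖) := by
    gcongr
  calc _ ≤ M * ρ * ‖v‖ + δ * ρ * ‖h‖ + 2 * (ε * (ρ + L) * (‖h‖ + ‖v‖)) :=
        (norm_add₃_le).trans (add_le_add (add_le_add e1 e2) e3)
    _ = (M * ρ + 2 * ε * (ρ + L)) * ‖v‖ + (δ * ρ + 2 * ε * (ρ + L)) * ‖h‖ := by ring
    _ ≤ _ := by linarith

/-- The map `f` taking `x` to the endpoint of the radial lift is, to first order, tangent to the graphs of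
`a`, up to an error controlled by the failure of involutivity `δ` and by the size `M` of the
exterior derivative of `θ`. -/
lemma eventually_radial_estimate [FiniteDimensional ℝ P] {θ : P × Q → (P × Q →L[ℝ] Q)}
    {R ρ M δ : ℝ} (hρ : 0 < ρ) (hρR : ρ < R) (hM0 : 0 ≤ M) (hδ0 : 0 ≤ δ)
    (hθ : ContDiffOn ℝ 1 θ (Metric.ball 0 R))
    (hsnd : ∀ z ∈ Metric.ball (0 : P × Q) R, ‖θ z - ContinuousLinearMap.snd ℝ P Q‖ ≤ 1 / 2)
    (hM : ∀ z ∈ Metric.ball (0 : P × Q) R, ∀ u w, ‖curl θ z u w‖ ≤ M * ‖u‖ * ‖w‖)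
    (hδ : ∀ z ∈ Metric.ball (0 : P × Q) R, ∀ u w, θ z u = 0 → θ z w = 0 →
      ‖curl θ z u w‖ ≤ δ * ‖u‖ * ‖w‖) :
    ∃ f : P → Q, f 0 = 0 ∧ (∀ x ∈ Metric.closedBall (0 : P) ρ, ‖f x‖ ≤ ρ) ∧
      ∀ x ∈ Metric.ball (0 : P) ρ, ∀ C > 2 * (δ * ρ) * Real.exp (2 * (M * ρ)),
        ∀ᶠ h in 𝓝 (0 : P), ‖f (x + h) - f x - graphSlope (θ (x, f x)) h‖ ≤ C * ‖h‖ := by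
  set a : P × Q → P →L[ℝ] Q := fun z => graphSlope (θ z) with ha_def
  set K : Set (P × Q) := Metric.closedBall 0 ρ with hK_def
  have hKR : K ⊆ Metric.ball 0 R := Metric.closedBall_subset_ball hρR
  have ha1 : ContDiffOn ℝ 1 a (Metric.ball 0 R) := fun z hz =>
    (contDiffAt_graphSlope (hsnd z hz)).comp_contDiffWithinAt z (hθ z hz)
  have hKc : IsCompact K := isCompact_closedBall _ _
  have hKconv : Convex ℝ K := convex_closedBall _ _
  obtain ⟨⟨L, hL, hLK⟩, htaylor⟩ :=
    exists_uniform_taylor Metric.isOpen_ball ha1 hKc hKconv hKR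
  have hadiff : ∀ z ∈ K, DifferentiableAt ℝ a z := fun z hz =>
    (ha1.differentiableOn one_ne_zero).differentiableAt (Metric.isOpen_ball.mem_nhds (hKR hz))
  have hθdiff : ∀ z ∈ K, DifferentiableAt ℝ θ z := fun z hz =>
    (hθ.differentiableOn one_ne_zero).differentiableAt (Metric.isOpen_ball.mem_nhds (hKR hz))
  have hlip : ∀ z ∈ K, ∀ z' ∈ K, ‖a z' - a z‖ ≤ L * ‖z' - z‖ := fun z hz z' hz' =>
    hKconv.norm_image_sub_le_of_norm_hasFDerivWithin_le
      (fun w hw => (hadiff w hw).hasFDerivAt.hasFDerivWithinAt) hLK hz hz'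
  have ha : ∀ z ∈ K, ∀ ξ, ‖a z ξ‖ ≤ ‖ξ‖ := fun z hz ξ =>
    norm_graphSlope_apply_le (hsnd z (hKR hz)) ξ
  have hacont : ContinuousOn a K := ha1.continuousOn.mono hKR
  have hex : ∀ x : P, ∃ g : ℝ → Q, ‖x‖ ≤ ρ → g 0 = 0 ∧ (∀ s ∈ Icc (0 : ℝ) 1, ‖g s‖ ≤ ρ) ∧
      ∀ s ∈ Icc (0 : ℝ) 1, HasDerivWithinAt g (a (s • x, g s) x) (Icc 0 1) s := fun x => by
    by_cases hx : ‖x‖ ≤ ρ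
    · obtain ⟨g, hg⟩ := exists_radial_lift hρ hL hacont ha hlip hx
      exact ⟨g, fun _ => hg⟩
    · exact ⟨0, fun h => absurd h hx⟩
  choose g hg using hex
  have hmem : ∀ x : P, ‖x‖ ≤ ρ → ∀ s ∈ Icc (0 : ℝ) 1, ((s • x, g x s) : P × Q) ∈ K := by
    intro x hx s hs
    rw [hK_def, mem_closedBall_zero_iff]
    refine norm_prod_le_iff.2 ⟨?_, (hg x hx).2.1 s hs⟩
    rw [norm_smul, Real.norm_of_nonneg hs.1]
    nlinarith [hs.2, norm_nonneg x]
  have hderiv : ∀ x : P, ‖x‖ ≤ ρ → ∀ s ∈ Ico (0 : ℝ) 1,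
      HasDerivWithinAt (g x) (a (s • x, g x s) x) (Ici s) s := fun x hx s hs =>
    ((hg x hx).2.2 s ⟨hs.1, hs.2.le⟩).mono_of_mem_nhdsWithin (Icc_mem_nhdsGE_of_mem hs)
  have hgcont : ∀ x : P, ‖x‖ ≤ ρ → ContinuousOn (g x) (Icc 0 1) := fun x hx s hs =>
    ((hg x hx).2.2 s hs).continuousWithinAt
  refine ⟨fun x => g x 1, ?_, ?_, ?_⟩
  · -- the radial lift of the constant segment at `0` is constant
    have h0 : ‖(0 : P)‖ ≤ ρ := by simpa using hρ.le
    have := norm_le_mul_exp_of_norm_deriv_right_le le_rfl le_rfl (hgcont 0 h0) (hderiv 0 h0)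
      (hg 0 h0).1 (by simp) 1 (by simp)
    simpa using this
  · intro x hx
    exact (hg x (by simpa using hx)).2.1 1 (by simp)
  intro x hx C hC
  have hxρ : ‖x‖ < ρ := by simpa using hx
  -- choose the error parameter `ε` of the Taylor expansion
  obtain ⟨ε, hε, hεC⟩ : ∃ ε > 0, 2 * ((δ * ρ + 2 * ε * (ρ + L)) *
      Real.exp (2 * (M * ρ + 2 * ε * (ρ + L)))) < C := by
    have hc : ContinuousAt (fun ε : ℝ => 2 * ((δ * ρ + 2 * ε * (ρ + L)) *
      Real.exp (2 * (M * ρ + 2 * ε * (ρ + L))))) 0 := by fun_prop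
    have h1 : ∀ᶠ ε in 𝓝 (0 : ℝ), 2 * ((δ * ρ + 2 * ε * (ρ + L)) *
        Real.exp (2 * (M * ρ + 2 * ε * (ρ + L)))) < C :=
      hc.eventually_lt_const (by simpa [mul_assoc] using hC)
    exact ((eventually_mem_nhdsWithin (s := Ioi (0 : ℝ))).and
      (h1.filter_mono nhdsWithin_le_nhds)).exists
  obtain ⟨η, hη, htay⟩ := htaylor ε hε
  -- the Lipschitz constant of the radial lift in its endpoint
  set C₁ : ℝ := 1 + (L * ρ + 1) * Real.exp (L * ρ) with hC₁
  have hC₁pos : 0 < C₁ := by positivity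
  have ev1 : ∀ᶠ h in 𝓝 (0 : P), ‖h‖ < min (min (ρ - ‖x‖) ε) (η / C₁) := by
    have : 0 < min (min (ρ - ‖x‖) ε) (η / C₁) :=
      lt_min (lt_min (sub_pos.2 hxρ) hε) (by positivity)
    filter_upwards [Metric.ball_mem_nhds (0 : P) this] with h hh using mem_ball_zero_iff.1 hh
  filter_upwards [ev1] with h hh
  have hh1 : ‖h‖ < ρ - ‖x‖ := hh.trans_le ((min_le_left _ _).trans (min_le_left _ _))
  have hh2 : ‖h‖ ≤ ε := (hh.trans_le ((min_le_left _ _).trans (min_le_right _ _))).le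
  have hh3 : C₁ * ‖h‖ < η := by
    have := hh.trans_le (min_le_right _ _)
    rwa [lt_div_iff₀ hC₁pos, mul_comm] at this
  have hx' : ‖x‖ ≤ ρ := hxρ.le
  have hxh : ‖x + h‖ ≤ ρ := (norm_add_le _ _).trans (by linarith)
  -- crude bound for the distance of the two lifts
  have hcrude : ∀ s ∈ Icc (0 : ℝ) 1,
      ‖g (x + h) s - g x s‖ ≤ (L * ρ + 1) * ‖h‖ * Real.exp (L * ρ) := by
    refine norm_le_mul_exp_of_norm_deriv_right_le (by positivity) (by positivity)
      ((hgcont _ hxh).sub (hgcont _ hx')) (fun s hs => (hderiv _ hxh s hs).sub (hderiv _ hx' s hs))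
      (by simp [(hg _ hxh).1, (hg _ hx').1]) fun s hs => ?_
    have hs' : s ∈ Icc (0 : ℝ) 1 := ⟨hs.1, hs.2.le⟩
    have h1 : a (s • (x + h), g (x + h) s) (x + h) - a (s • x, g x s) x
        = (a (s • (x + h), g (x + h) s) - a (s • x, g x s)) x
          + a (s • (x + h), g (x + h) s) h := by
      rw [map_add, sub_apply]; abel
    have h2 := hlip _ (hmem _ hx' s hs') _ (hmem _ hxh s hs')
    have h3 : ‖((s • (x + h), g (x + h) s) : P × Q) - (s • x, g x s)‖
        ≤ ‖h‖ + ‖g (x + h) s - g x s‖ := by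
      refine norm_prod_le_iff.2 ⟨?_, ?_⟩
      · have : s • (x + h) - s • x = s • h := by module
        simp only [Prod.fst_sub, this, norm_smul, Real.norm_of_nonneg hs.1]
        nlinarith [hs.2, norm_nonneg h, norm_nonneg (g (x + h) s - g x s)]
      · simp
    rw [h1]
    calc _ ≤ ‖a (s • (x + h), g (x + h) s) - a (s • x, g x s)‖ * ‖x‖ + ‖h‖ :=
          (norm_add_le _ _).trans (add_le_add (ContinuousLinearMap.le_opNorm _ _)
            (ha _ (hmem _ hxh s hs') _))
      _ ≤ (L * (‖h‖ + ‖g (x + h) s - g x s‖)) * ρ + ‖h‖ := by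
          gcongr
          exact h2.trans (by gcongr)
      _ = L * ρ * ‖g (x + h) s - g x s‖ + (L * ρ + 1) * ‖h‖ := by ring
  -- the refined estimate
  set v : ℝ → Q := fun s => g (x + h) s - g x s - s • a (s • x, g x s) h with hv_def
  set z : ℝ → P × Q := fun s => (s • x, g x s) with hz_def
  have hzderiv : ∀ s ∈ Ico (0 : ℝ) 1, HasDerivWithinAt z (x, a (z s) x) (Ici s) s := fun s hs => by
    have h1 : HasDerivWithinAt (fun s : ℝ => s • x) x (Ici s) s := by
      simpa using (hasDerivWithinAt_id s (Ici s)).smul_const x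
    exact h1.prodMk (hderiv x hx' s hs)
  have hzcont : ContinuousOn z (Icc 0 1) := by
    have := hgcont x hx'
    fun_prop
  have hzK : ∀ s ∈ Icc (0 : ℝ) 1, z s ∈ K := fun s hs => hmem x hx' s hs
  have hvderiv : ∀ s ∈ Ico (0 : ℝ) 1, HasDerivWithinAt v
      (a (s • (x + h), g (x + h) s) (x + h) - a (z s) x
        - (a (z s) h + s • fderiv ℝ a (z s) (x, a (z s) x) h)) (Ici s) s := fun s hs => by
    have hs' : s ∈ Icc (0 : ℝ) 1 := ⟨hs.1, hs.2.le⟩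
    have h1 : HasDerivWithinAt (fun s => a (z s)) (fderiv ℝ a (z s) (x, a (z s) x)) (Ici s) s :=
      (hadiff _ (hzK s hs')).hasFDerivAt.comp_hasDerivWithinAt s (hzderiv s hs)
    have h2 : HasDerivWithinAt (fun s => a (z s) h) (fderiv ℝ a (z s) (x, a (z s) x) h)
        (Ici s) s := by
      simpa using h1.clm_apply (hasDerivWithinAt_const s (Ici s) h)
    have h3 := (hasDerivWithinAt_id s (Ici s)).smul h2
    refine (((hderiv _ hxh s hs).sub (hderiv _ hx' s hs)).sub h3).congr_deriv ?_
    simp [hz_def]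
    abel
  have hazcont : ContinuousOn (fun s => a (z s)) (Icc 0 1) := hacont.comp hzcont hzK
  have hvcont : ContinuousOn v (Icc 0 1) :=
    ((hgcont _ hxh).sub (hgcont _ hx')).sub
      (continuousOn_id.smul (hazcont.clm_apply continuousOn_const))
  have hθz : ContinuousOn (fun s => θ (z s)) (Icc 0 1) :=
    hθ.continuousOn.comp hzcont fun s hs => hKR (hzK s hs)
  have hw := norm_le_mul_exp_of_norm_deriv_right_le
    (f := fun s => θ (z s) (0, v s))
    (f' := fun s => fderiv ℝ θ (z s) (x, a (z s) x) (0, v s)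
      + θ (z s) (0, a (s • (x + h), g (x + h) s) (x + h) - a (z s) x
        - (a (z s) h + s • fderiv ℝ a (z s) (x, a (z s) x) h)))
    (K := 2 * (M * ρ + 2 * ε * (ρ + L))) (ε := (δ * ρ + 2 * ε * (ρ + L)) * ‖h‖)
    (by positivity) (by positivity)
    (hθz.clm_apply (continuousOn_const.prodMk hvcont))
    (fun s hs => by
      have hs' : s ∈ Icc (0 : ℝ) 1 := ⟨hs.1, hs.2.le⟩
      exact ((hθdiff _ (hzK s hs')).hasFDerivAt.comp_hasDerivWithinAt s (hzderiv s hs)).clm_apply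
        ((hasDerivWithinAt_const s (Ici s) (0 : P)).prodMk (hvderiv s hs)))
    (by simp only [hv_def, (hg _ hxh).1, (hg _ hx').1, sub_zero, zero_smul]; exact map_zero _)
    (fun s hs => by
      have hs' : s ∈ Icc (0 : ℝ) 1 := ⟨hs.1, hs.2.le⟩
      have hzs := hzK s hs'
      have hinc : ((s • (x + h), g (x + h) s) : P × Q) - z s = (s • h, s • a (z s) h + v s) := by
        ext
        · simp [hz_def]
        · simp [hz_def, hv_def]
      have hsmall : ‖((s • (x + h), g (x + h) s) : P × Q) - z s‖ < η := by
        refine lt_of_le_of_lt ?_ hh3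
        have h0 := hcrude s hs'
        have hE := Real.exp_pos (L * ρ)
        refine norm_prod_le_iff.2 ⟨?_, ?_⟩
        · rw [hinc]
          simp only [norm_smul, Real.norm_of_nonneg hs.1]
          have : s * ‖h‖ ≤ 1 * ‖h‖ := by gcongr; exact hs.2.le
          have h5 : 0 ≤ (L * ρ + 1) * Real.exp (L * ρ) * ‖h‖ := by positivity
          rw [hC₁]; linarith
        · simp only [hz_def, Prod.snd_sub]
          refine h0.trans ?_
          rw [hC₁]
          nlinarith [norm_nonneg h]
      have hne : ∀ᶠ z' in 𝓝 (z s), ∀ ξ, θ z' (ξ, a z' ξ) = 0 := by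
        filter_upwards [Metric.isOpen_ball.mem_nhds (hKR hzs)] with z' hz' ξ
        exact apply_graphSlope (hsnd z' hz') ξ
      refine norm_deriv_radial_le hM0 hδ0 hε.le hL (hsnd _ (hKR hzs))
        (fun ξ => apply_graphSlope (hsnd _ (hKR hzs)) ξ)
        (fun u ξ => apply_fderiv_slope (hθdiff _ hzs) (hadiff _ hzs) hne u ξ)
        (hM _ (hKR hzs)) (hδ _ (hKR hzs)) hs' hx' hh2 ?_ ?_
      · rw [← hinc]
        exact htay _ hzs _ (hmem _ hxh s hs') hsmall
      · rw [← hinc]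
        exact hlip _ hzs _ (hmem _ hxh s hs'))
    1 (by simp)
  have hz1 : z 1 = (x, g x 1) := by simp [hz_def]
  have hv1 : v 1 = g (x + h) 1 - g x 1 - a (x, g x 1) h := by simp [hv_def]
  have hfin := norm_le_two_mul_of_near_snd (hsnd _ (hKR (hzK 1 (by simp)))) (v 1)
  rw [← hv1]
  refine hfin.trans ?_
  calc 2 * ‖θ (z 1) (0, v 1)‖
      ≤ 2 * ((δ * ρ + 2 * ε * (ρ + L)) * ‖h‖ * Real.exp (2 * (M * ρ + 2 * ε * (ρ + L)))) := by
        gcongr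
    _ = (2 * ((δ * ρ + 2 * ε * (ρ + L)) * Real.exp (2 * (M * ρ + 2 * ε * (ρ + L))))) * ‖h‖ := by
        ring
    _ ≤ C * ‖h‖ := by gcongr

end Approximate

/-! ### Passage to the limit: existence of integral graphs -/

section Limit

variable {P Q : Type*} [NormedAddCommGroup P] [NormedSpace ℝ P]
  [NormedAddCommGroup Q] [NormedSpace ℝ Q]

/-- A mean value inequality for maps which are differentiable up to an error `C`. -/
lemma norm_sub_le_of_almost_hasFDerivAt {f : P → Q} {b : P → P →L[ℝ] Q} {s : Set P} {C B : ℝ}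
    (hs : Convex ℝ s) (hf : ∀ x ∈ s, ∀ᶠ h in 𝓝 (0 : P), ‖f (x + h) - f x - b x h‖ ≤ C * ‖h‖)
    {x h : P} (hx : x ∈ s) (hxh : x + h ∈ s) (A : P →L[ℝ] Q)
    (hA : ∀ y ∈ segment ℝ x (x + h), ‖b y h - A h‖ ≤ B) :
    ‖f (x + h) - f x - A h‖ ≤ C * ‖h‖ + B := by
  have hseg : ∀ u ∈ Icc (0 : ℝ) 1, x + u • h ∈ segment ℝ x (x + h) := fun u hu => by
    rw [segment_eq_image']
    exact ⟨u, hu, by simp⟩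
  have hmem : ∀ u ∈ Icc (0 : ℝ) 1, x + u • h ∈ s := fun u hu => hs.segment_subset hx hxh (hseg u hu)
  have hcont : ∀ y ∈ s, ContinuousAt f y := by
    intro y hy
    have h1 : Tendsto (fun k : P => f (y + k)) (𝓝 0) (𝓝 (f y)) := by
      rw [tendsto_iff_norm_sub_tendsto_zero]
      have h2 : Tendsto (fun k : P => C * ‖k‖ + ‖b y‖ * ‖k‖) (𝓝 0) (𝓝 0) := by
        have : Continuous fun k : P => C * ‖k‖ + ‖b y‖ * ‖k‖ := by fun_prop
        simpa using this.tendsto 0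
      refine squeeze_zero' (Eventually.of_forall fun _ => norm_nonneg _) ?_ h2
      filter_upwards [hf y hy] with k hk
      calc ‖f (y + k) - f y‖ = ‖(f (y + k) - f y - b y k) + b y k‖ := by simp
        _ ≤ _ := (norm_add_le _ _).trans (add_le_add hk ((b y).le_opNorm k))
    have h3 := h1.comp (f := fun w => w - y) (x := 𝓝 y) (by
      have : Continuous fun w : P => w - y := by fun_prop
      simpa using this.tendsto y)
    exact h3.congr fun w => by simp
  set F : ℝ → Q := fun u => f (x + u • h) - u • A h with hF
  have hFc : ContinuousOn F (Icc 0 1) := by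
    refine ContinuousOn.sub (fun u hu => ?_) (by fun_prop)
    exact ((hcont _ (hmem u hu)).comp (f := fun u : ℝ => x + u • h) (by fun_prop)).continuousWithinAt
  have key := norm_sub_le_of_eventually_slope_le (C := C * ‖h‖ + B) hFc fun u hu => by
    have hu' : u ∈ Icc (0 : ℝ) 1 := ⟨hu.1, hu.2.le⟩
    have ht : Tendsto (fun t : ℝ => (t - u) • h) (𝓝[>] u) (𝓝 0) := by
      have : Continuous fun t : ℝ => (t - u) • h := by fun_prop
      simpa using (this.tendsto u).mono_left nhdsWithin_le_nhds
    filter_upwards [ht.eventually (hf _ (hmem u hu')), self_mem_nhdsWithin] with t ht1 htu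
    have htu : 0 < t - u := sub_pos.2 htu
    have e1 : x + u • h + (t - u) • h = x + t • h := by module
    have e2 : F t - F u = (f (x + t • h) - f (x + u • h) - b (x + u • h) ((t - u) • h))
        + (t - u) • (b (x + u • h) h - A h) := by
      simp only [hF, map_smul]; module
    rw [e1] at ht1
    rw [e2]
    refine (norm_add_le _ _).trans ?_
    rw [norm_smul, Real.norm_of_nonneg htu.le] at ht1 ⊢
    have := hA _ (hseg u hu')
    nlinarith
  have e3 : F 1 - F 0 = f (x + h) - f x - A h := by simp [hF]; abel
  rwa [e3] at key

/-- The `Q`-valued `1`-form `θ` on the ball of radius `R` of `P × Q` is of class `C¹`, is close to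
the projection to `Q`, and is involutive up to an error `δ` such that `δ exp (c M) ≤ τ`, where `M`
bounds the exterior derivative of `θ`. -/
def IsAlmostInvolutive (R c τ : ℝ) (θ : P × Q → (P × Q →L[ℝ] Q)) : Prop :=
  ContDiffOn ℝ 1 (θ) (Metric.ball 0 R) ∧
  (∀ z ∈ Metric.ball (0 : P × Q) R, ‖θ z - ContinuousLinearMap.snd ℝ P Q‖ ≤ 1 / 2) ∧
  ∃ M δ : ℝ, 0 ≤ M ∧ 0 ≤ δ ∧
    (∀ z ∈ Metric.ball (0 : P × Q) R, ∀ u w, ‖curl (θ) z u w‖ ≤ M * ‖u‖ * ‖w‖) ∧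
    (∀ z ∈ Metric.ball (0 : P × Q) R, ∀ u w, θ z u = 0 → θ z w = 0 →
      ‖curl (θ) z u w‖ ≤ δ * ‖u‖ * ‖w‖) ∧
    δ * Real.exp (c * M) ≤ τ

/-- Existence of an integral graph through the origin, for a continuous form `θ` which is a
uniform limit of `C¹` forms whose failure `δ` of involutivity beats the exponential of the size
`M` of their exterior derivatives. -/
theorem exists_integral_graph [FiniteDimensional ℝ P] [FiniteDimensional ℝ Q]
    {θ : P × Q → (P × Q →L[ℝ] Q)} {θs : ℕ → P × Q → (P × Q →L[ℝ] Q)} {R ρ c : ℝ} {τ : ℕ → ℝ}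
    (hρ : 0 < ρ) (hρR : ρ < R) (hρc : 2 * ρ ≤ c)
    (hcont : ContinuousOn θ (Metric.ball 0 R))
    (hsnd : ∀ z ∈ Metric.ball (0 : P × Q) R, ‖θ z - ContinuousLinearMap.snd ℝ P Q‖ ≤ 1 / 2)
    (hconv : ∀ ε > 0, ∀ᶠ k in atTop, ∀ z ∈ Metric.ball (0 : P × Q) R, ‖θs k z - θ z‖ ≤ ε)
    (hτ : Tendsto τ atTop (𝓝 0))
    (H : ∀ᶠ k in atTop, IsAlmostInvolutive R c (τ k) (θs k)) :
    ∃ f : P → Q, f 0 = 0 ∧ ∀ x ∈ Metric.ball (0 : P) ρ, ‖f x‖ ≤ ρ ∧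
      HasFDerivAt f (graphSlope (θ (x, f x))) x := by
  set C : ℕ → ℝ := fun k => 2 * ρ * τ k + 1 / ((k : ℝ) + 1) with hC_def
  have hC : Tendsto C atTop (𝓝 0) := by
    simpa [hC_def] using (hτ.const_mul (2 * ρ)).add tendsto_one_div_add_atTop_nhds_zero_nat
  have happrox : ∀ k, ∃ f : P → Q, IsAlmostInvolutive R c (τ k) (θs k) → f 0 = 0 ∧ (∀ x ∈ Metric.closedBall (0 : P) ρ, ‖f x‖ ≤ ρ) ∧
        ∀ x ∈ Metric.ball (0 : P) ρ, ∀ᶠ h in 𝓝 (0 : P),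
          ‖f (x + h) - f x - graphSlope (θs k (x, f x)) h‖ ≤ C k * ‖h‖ := by
    intro k
    by_cases hk : IsAlmostInvolutive R c (τ k) (θs k)
    · obtain ⟨h1, h2, M, δ, hM0, hδ0, hM, hδ, hMδ⟩ := id hk
      obtain ⟨f, hf0, hfρ, hf⟩ := eventually_radial_estimate hρ hρR hM0 hδ0 h1 h2 hM hδ
      refine ⟨f, fun _ => ⟨hf0, hfρ, fun x hx => hf x hx (C k) ?_⟩⟩
      have h3 : Real.exp (2 * (M * ρ)) ≤ Real.exp (c * M) := Real.exp_le_exp.2 (by nlinarith)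
      have h4 : 2 * (δ * ρ) * Real.exp (2 * (M * ρ)) ≤ 2 * ρ * τ k := by
        calc 2 * (δ * ρ) * Real.exp (2 * (M * ρ)) ≤ 2 * (δ * ρ) * Real.exp (c * M) := by gcongr
          _ = 2 * ρ * (δ * Real.exp (c * M)) := by ring
          _ ≤ _ := by gcongr
      have h5 : (0 : ℝ) < 1 / ((k : ℝ) + 1) := by positivity
      simp only [hC_def]
      linarith
    · exact ⟨0, fun h => absurd h hk⟩
  choose fs hfs using happrox
  set U : Ultrafilter ℕ := Ultrafilter.of atTop with hU_def
  have hU : (U : Filter ℕ) ≤ atTop := Ultrafilter.of_le _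
  have hgood := H.mono fun k hk => hfs k hk
  -- the pointwise limit along an ultrafilter replaces the Arzelà–Ascoli theorem
  have hlim : ∀ x : P, ∃ y : Q, x ∈ Metric.closedBall (0 : P) ρ →
      ‖y‖ ≤ ρ ∧ Tendsto (fun k => fs k x) U (𝓝 y) := by
    intro x
    by_cases hx : x ∈ Metric.closedBall (0 : P) ρ
    · have h1 : ((U.map fun k => fs k x : Ultrafilter Q) : Filter Q)
          ≤ 𝓟 (Metric.closedBall (0 : Q) ρ) := by
        rw [le_principal_iff]
        have : ∀ᶠ k in (U : Filter ℕ), fs k x ∈ Metric.closedBall (0 : Q) ρ :=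
          hU (hgood.mono fun k hk => by simpa using hk.2.1 x hx)
        exact this
      obtain ⟨y, hy, hyU⟩ := (isCompact_closedBall (0 : Q) ρ).ultrafilter_le_nhds _ h1
      exact ⟨y, fun _ => ⟨by simpa using hy, hyU⟩⟩
    · exact ⟨0, fun h => absurd h hx⟩
  choose f hf using hlim
  refine ⟨f, ?_, fun x hx => ⟨(hf x (Metric.ball_subset_closedBall hx)).1, ?_⟩⟩
  · refine tendsto_nhds_unique (hf 0 (by simpa using hρ.le)).2 ?_
    refine tendsto_const_nhds.congr' ?_
    filter_upwards [hU hgood] with k hk using hk.1.symm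
  have hx' := Metric.ball_subset_closedBall hx
  have hxρ : ‖x‖ < ρ := by simpa using hx
  have hmemR : ∀ y ∈ Metric.ball (0 : P) ρ, ∀ q : Q, ‖q‖ ≤ ρ →
      ((y, q) : P × Q) ∈ Metric.ball (0 : P × Q) R := by
    intro y hy q hq
    rw [mem_ball_zero_iff] at hy ⊢
    exact lt_of_le_of_lt (norm_prod_le_iff.2 ⟨hy.le, hq⟩) hρR
  set z₀ : P × Q := (x, f x) with hz₀
  have hz₀R : z₀ ∈ Metric.ball (0 : P × Q) R := hmemR x hx _ (hf x hx').1
  have hacont : ContinuousAt (fun z => graphSlope (θ z)) z₀ :=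
    (contDiffAt_graphSlope (hsnd z₀ hz₀R)).continuousAt.comp
      (hcont.continuousAt (Metric.isOpen_ball.mem_nhds hz₀R))
  rw [hasFDerivAt_iff_isLittleO_nhds_zero, Asymptotics.isLittleO_iff]
  intro ε hε
  obtain ⟨η, hη, hηa⟩ := Metric.continuousAt_iff.1 hacont (ε / 4) (by positivity)
  have hmin : 0 < min (η / 4) (ρ - ‖x‖) := lt_min (by positivity) (sub_pos.2 hxρ)
  filter_upwards [Metric.ball_mem_nhds (0 : P) hmin] with h hh
  rw [mem_ball_zero_iff] at hh
  have hh1 : ‖h‖ < η / 4 := hh.trans_le (min_le_left _ _)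
  have hh2 : ‖h‖ < ρ - ‖x‖ := hh.trans_le (min_le_right _ _)
  have hxh : x + h ∈ Metric.ball (0 : P) ρ := by
    rw [mem_ball_zero_iff]
    exact (norm_add_le _ _).trans_lt (by linarith)
  have hlimk : Tendsto (fun k => ‖fs k (x + h) - fs k x - graphSlope (θ z₀) h‖) U
      (𝓝 ‖f (x + h) - f x - graphSlope (θ z₀) h‖) :=
    (((hf _ (Metric.ball_subset_closedBall hxh)).2.sub (hf x hx').2).sub_const _).norm
  refine le_of_tendsto hlimk ?_
  have ev1 : ∀ᶠ k in (U : Filter ℕ), C k < min 1 (ε / 4) :=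
    hU (hC.eventually_lt_const (lt_min one_pos (by positivity)))
  have ev2 : ∀ᶠ k in (U : Filter ℕ), ‖fs k x - f x‖ < η / 4 := by
    have := Metric.tendsto_nhds.1 (hf x hx').2 (η / 4) (by positivity)
    simpa [dist_eq_norm] using this
  filter_upwards [ev1, ev2, hU (hconv (ε / 8) (by positivity)), hU hgood, hU H]
    with k hk1 hk2 hk3 hk4 hk5
  have hC1 : C k ≤ 1 := (hk1.trans_le (min_le_left _ _)).le
  have hC2 : C k ≤ ε / 4 := (hk1.trans_le (min_le_right _ _)).le
  have hconvex : Convex ℝ (Metric.ball (0 : P) ρ) := convex_ball _ _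
  have hfk : ∀ y ∈ Metric.ball (0 : P) ρ, ((y, fs k y) : P × Q) ∈ Metric.ball (0 : P × Q) R :=
    fun y hy => hmemR y hy _ (hk4.2.1 y (Metric.ball_subset_closedBall hy))
  have hbd : ∀ y ∈ Metric.ball (0 : P) ρ, ∀ ξ, ‖graphSlope (θs k (y, fs k y)) ξ‖ ≤ ‖ξ‖ :=
    fun y hy ξ => norm_graphSlope_apply_le (hk5.2.1 _ (hfk y hy)) ξ
  have hslopes : ∀ y ∈ segment ℝ x (x + h),
      ‖graphSlope (θs k (y, fs k y)) h - graphSlope (θ z₀) h‖ ≤ ε / 2 * ‖h‖ := by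
    intro y hy
    have hyρ := hconvex.segment_subset hx hxh hy
    obtain ⟨u, hu, rfl⟩ : ∃ u ∈ Icc (0 : ℝ) 1, x + u • h = y := by
      rw [segment_eq_image'] at hy
      obtain ⟨u, hu, rfl⟩ := hy
      exact ⟨u, hu, by simp⟩
    have huh : ‖u • h‖ ≤ ‖h‖ := by
      rw [norm_smul, Real.norm_of_nonneg hu.1]
      nlinarith [hu.2, norm_nonneg h]
    have h1 : ‖fs k (x + u • h) - fs k x‖ ≤ 2 * ‖h‖ := by
      have h2 := norm_sub_le_of_almost_hasFDerivAt (B := ‖u • h‖) hconvex hk4.2.2 hx hyρ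
        (0 : P →L[ℝ] Q) (fun y hy => by
          simpa using hbd y (hconvex.segment_subset hx hyρ hy) (u • h))
      simp only [zero_apply, sub_zero] at h2
      nlinarith [norm_nonneg (u • h)]
    have h3 : dist ((x + u • h, fs k (x + u • h)) : P × Q) z₀ < η := by
      rw [dist_eq_norm, hz₀]
      refine lt_of_le_of_lt ((norm_prod_le_iff (r := 2 * ‖h‖ + ‖fs k x - f x‖)).2 ⟨?_, ?_⟩)
        (by linarith)
      · simp only [Prod.fst_sub, add_sub_cancel_left]
        linarith [norm_nonneg h, norm_nonneg (fs k x - f x)]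
      · have : fs k (x + u • h) - f x = (fs k (x + u • h) - fs k x) + (fs k x - f x) := by abel
        simp only [Prod.snd_sub]
        rw [this]
        exact (norm_add_le _ _).trans (by linarith)
    have h4 := (hηa h3).le
    rw [dist_eq_norm] at h4
    have hzR := hfk _ hyρ
    have h5 := (norm_graphSlope_sub_le (hk5.2.1 _ hzR) (hsnd _ hzR)).trans
      (mul_le_mul_of_nonneg_left (hk3 _ hzR) zero_le_two)
    rw [← sub_apply]
    refine ContinuousLinearMap.le_of_opNorm_le _ ?_ h
    calc _ = ‖(graphSlope (θs k (x + u • h, fs k (x + u • h)))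
              - graphSlope (θ (x + u • h, fs k (x + u • h))))
            + (graphSlope (θ (x + u • h, fs k (x + u • h))) - graphSlope (θ z₀))‖ := by
          congr 1; abel
      _ ≤ _ := norm_add_le _ _
      _ ≤ ε / 2 := by linarith
  have := norm_sub_le_of_almost_hasFDerivAt hconvex hk4.2.2 hx hxh (graphSlope (θ z₀)) hslopes
  refine this.trans ?_
  nlinarith [norm_nonneg h]

end Limit

/-! ### Uniqueness: Stokes' theorem on the strip between two integral curves -/

section Uniqueness

variable {P Q : Type*} [NormedAddCommGroup P] [NormedSpace ℝ P] [FiniteDimensional ℝ P]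
  [NormedAddCommGroup Q] [NormedSpace ℝ Q] [FiniteDimensional ℝ Q]

set_option maxHeartbeats 1000000 in
/-- Two curves with the same projection to `P`, which start at the same point and are almost
tangent to the kernel of a `C¹` form `θ`, stay close to each other. The integral `I(s)` of `θ` over
the segment from `γ₁ s` to `γ₂ s` is comparable to the distance of the curves, and by Stokes'
theorem its growth only involves the exterior derivative of `θ` and the values of `θ` on the
velocities. -/
lemma norm_sub_le_of_almost_tangent {θ : P × Q → (P × Q →L[ℝ] Q)} {R ρ M K κ : ℝ}
    (hρR : ρ < R) (hM0 : 0 ≤ M) (hK0 : 0 ≤ K) (hκ0 : 0 ≤ κ)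
    (hθ : ContDiffOn ℝ 1 θ (Metric.ball 0 R))
    (hsnd : ∀ z ∈ Metric.ball (0 : P × Q) R, ‖θ z - ContinuousLinearMap.snd ℝ P Q‖ ≤ 1 / 2)
    (hM : ∀ z ∈ Metric.ball (0 : P × Q) R, ∀ u w, ‖curl θ z u w‖ ≤ M * ‖u‖ * ‖w‖)
    {γ₁ γ₂ γ₁' γ₂' : ℝ → P × Q}
    (h1 : ∀ s ∈ Ioo (-1 : ℝ) 2, HasDerivAt γ₁ (γ₁' s) s)
    (h2 : ∀ s ∈ Ioo (-1 : ℝ) 2, HasDerivAt γ₂ (γ₂' s) s)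
    (hb1 : ∀ s ∈ Ioo (-1 : ℝ) 2, γ₁ s ∈ Metric.closedBall (0 : P × Q) ρ)
    (hb2 : ∀ s ∈ Ioo (-1 : ℝ) 2, γ₂ s ∈ Metric.closedBall (0 : P × Q) ρ)
    (hfst : ∀ s ∈ Ioo (-1 : ℝ) 2, (γ₁ s).1 = (γ₂ s).1)
    (hK1 : ∀ s ∈ Ioo (-1 : ℝ) 2, ‖γ₁' s‖ ≤ K) (hK2 : ∀ s ∈ Ioo (-1 : ℝ) 2, ‖γ₂' s‖ ≤ K)
    (ht1 : ∀ s ∈ Ioo (-1 : ℝ) 2, ‖θ (γ₁ s) (γ₁' s)‖ ≤ κ)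
    (ht2 : ∀ s ∈ Ioo (-1 : ℝ) 2, ‖θ (γ₂ s) (γ₂' s)‖ ≤ κ)
    (h0 : γ₁ 0 = γ₂ 0) :
    ‖γ₂ 1 - γ₁ 1‖ ≤ 4 * κ * Real.exp (2 * (M * K)) := by
  have : CompleteSpace Q := FiniteDimensional.complete ℝ Q
  have hBR : Metric.closedBall (0 : P × Q) ρ ⊆ Metric.ball 0 R := Metric.closedBall_subset_ball hρR
  obtain ⟨⟨L, hL, hLB⟩, -⟩ := exists_uniform_taylor Metric.isOpen_ball hθ
    (isCompact_closedBall (0 : P × Q) ρ) (convex_closedBall _ _) hBR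
  have hdiff : ∀ z ∈ Metric.closedBall (0 : P × Q) ρ, HasFDerivAt θ (fderiv ℝ θ z) z := fun z hz =>
    ((hθ.differentiableOn one_ne_zero).differentiableAt
      (Metric.isOpen_ball.mem_nhds (hBR hz))).hasFDerivAt
  have hθc : ContinuousOn θ (Metric.closedBall (0 : P × Q) ρ) := hθ.continuousOn.mono hBR
  have hDc : ContinuousOn (fderiv ℝ θ) (Metric.closedBall (0 : P × Q) ρ) :=
    (hθ.continuousOn_fderiv_of_isOpen Metric.isOpen_ball le_rfl).mono hBR
  set v : ℝ → P × Q := fun s => γ₂ s - γ₁ s with hv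
  set v' : ℝ → P × Q := fun s => γ₂' s - γ₁' s with hv'
  set S : ℝ → ℝ → P × Q := fun s u => γ₁ s + u • v s with hS
  set T : ℝ → ℝ → P × Q := fun s u => γ₁' s + u • v' s with hT
  have hvd : ∀ s ∈ Ioo (-1 : ℝ) 2, HasDerivAt v (v' s) s := fun s hs => (h2 s hs).sub (h1 s hs)
  have hSmem : ∀ s ∈ Ioo (-1 : ℝ) 2, ∀ u ∈ Icc (0 : ℝ) 1,
      S s u ∈ Metric.closedBall (0 : P × Q) ρ := fun s hs u hu =>
    (convex_closedBall (0 : P × Q) ρ).add_smul_sub_mem (hb1 s hs) (hb2 s hs) hu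
  have hTmem : ∀ s ∈ Ioo (-1 : ℝ) 2, ∀ u ∈ Icc (0 : ℝ) 1, ‖T s u‖ ≤ K := fun s hs u hu => by
    have := (convex_closedBall (0 : P × Q) K).add_smul_sub_mem
      (mem_closedBall_zero_iff.2 (hK1 s hs)) (mem_closedBall_zero_iff.2 (hK2 s hs)) hu
    simpa using this
  have hv'le : ∀ s ∈ Ioo (-1 : ℝ) 2, ‖v' s‖ ≤ 2 * K := fun s hs =>
    (norm_sub_le _ _).trans (by linarith [hK1 s hs, hK2 s hs])
  have hvle : ∀ s ∈ Ioo (-1 : ℝ) 2, ‖v s‖ ≤ 2 * ρ := fun s hs => by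
    have e1 := mem_closedBall_zero_iff.1 (hb1 s hs)
    have e2 := mem_closedBall_zero_iff.1 (hb2 s hs)
    exact (norm_sub_le _ _).trans (by linarith)
  have hρ0 : 0 ≤ ρ := by
    have := mem_closedBall_zero_iff.1 (hb1 0 (by norm_num))
    exact (norm_nonneg _).trans this
  have hScont : ∀ s, Continuous (S s) := fun s => by fun_prop
  have hTcont : ∀ s, Continuous (T s) := fun s => by fun_prop
  have hSθ : ∀ s ∈ Ioo (-1 : ℝ) 2, ContinuousOn (fun u => θ (S s u)) (Icc 0 1) := fun s hs =>
    hθc.comp (hScont s).continuousOn (hSmem s hs)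
  have hSD : ∀ s ∈ Ioo (-1 : ℝ) 2, ContinuousOn (fun u => fderiv ℝ θ (S s u)) (Icc 0 1) :=
    fun s hs => hDc.comp (hScont s).continuousOn (hSmem s hs)
  set G : ℝ → ℝ → Q := fun s u => θ (S s u) (v s) with hG
  set G' : ℝ → ℝ → Q := fun s u => fderiv ℝ θ (S s u) (T s u) (v s) + θ (S s u) (v' s) with hG'
  have hGc : ∀ s ∈ Ioo (-1 : ℝ) 2, ContinuousOn (G s) (Icc 0 1) := fun s hs =>
    (hSθ s hs).clm_apply continuousOn_const
  have hG'c : ∀ s ∈ Ioo (-1 : ℝ) 2, ContinuousOn (G' s) (Icc 0 1) := fun s hs =>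
    (((hSD s hs).clm_apply (hTcont s).continuousOn).clm_apply continuousOn_const).add
      ((hSθ s hs).clm_apply continuousOn_const)
  have hGd : ∀ s ∈ Ioo (-1 : ℝ) 2, ∀ u ∈ Icc (0 : ℝ) 1,
      HasDerivAt (fun s => G s u) (G' s u) s := fun s hs u hu => by
    have e1 : HasDerivAt (fun s => S s u) (T s u) s := (h1 s hs).add ((hvd s hs).const_smul u)
    exact ((hdiff _ (hSmem s hs u hu)).comp_hasDerivAt s e1).clm_apply (hvd s hs)
  have hG'le : ∀ s ∈ Ioo (-1 : ℝ) 2, ∀ u ∈ Icc (0 : ℝ) 1,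
      ‖G' s u‖ ≤ L * K * (2 * ρ) + 2 * (2 * K) := fun s hs u hu => by
    have hz := hSmem s hs u hu
    refine (norm_add_le _ _).trans (add_le_add ?_ ?_)
    · refine (ContinuousLinearMap.le_opNorm₂ _ _ _).trans ?_
      gcongr
      · exact hLB _ hz
      · exact hTmem s hs u hu
      · exact hvle s hs
    · refine (ContinuousLinearMap.le_opNorm _ _).trans ?_
      gcongr
      · exact norm_le_two_of_near_snd (hsnd _ (hBR hz))
      · exact hv'le s hs
  set I : ℝ → Q := fun s => ∫ u in (0 : ℝ)..1, G s u with hI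
  have huIoc : ∀ u ∈ uIoc (0 : ℝ) 1, u ∈ Icc (0 : ℝ) 1 := fun u hu => by
    rw [uIoc_of_le zero_le_one] at hu; exact ⟨hu.1.le, hu.2⟩
  have hInt : ∀ {g : ℝ → Q}, ContinuousOn g (Icc 0 1) →
      IntervalIntegrable g MeasureTheory.volume 0 1 := fun hg =>
    ContinuousOn.intervalIntegrable (by rwa [uIcc_of_le zero_le_one])
  have hId : ∀ s ∈ Ioo (-1 : ℝ) 2, HasDerivAt I (∫ u in (0 : ℝ)..1, G' s u) s := fun s hs => by
    have hnhds : Ioo (-1 : ℝ) 2 ∈ 𝓝 s := isOpen_Ioo.mem_nhds hs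
    refine (intervalIntegral.hasDerivAt_integral_of_dominated_loc_of_deriv_le
      (F := G) (F' := G') (bound := fun _ => L * K * (2 * ρ) + 2 * (2 * K)) hnhds ?_
      (hInt (hGc s hs)) ?_ ?_ ?_ ?_).2
    · filter_upwards [hnhds] with t ht
      exact (hInt (hGc t ht)).def'.aestronglyMeasurable
    · exact (hInt (hG'c s hs)).def'.aestronglyMeasurable
    · exact MeasureTheory.ae_of_all _ fun u hu t ht => hG'le t ht u (huIoc u hu)
    · exact intervalIntegrable_const
    · exact MeasureTheory.ae_of_all _ fun u hu t ht => hGd t ht u (huIoc u hu)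
  -- `I s` controls the distance of the curves
  have hvI : ∀ s ∈ Ioo (-1 : ℝ) 2, ‖v s‖ ≤ 2 * ‖I s‖ := fun s hs => by
    have e0 : (v s).1 = 0 := by simp [hv, hfst s hs]
    have e1 : ‖v s‖ = ‖(v s).2‖ := by simp [Prod.norm_def, e0]
    have e2 : I s - (v s).2 = ∫ u in (0 : ℝ)..1, (G s u - (v s).2) := by
      rw [intervalIntegral.integral_sub (hInt (hGc s hs)) intervalIntegrable_const]
      simp [hI]
    have e3 : ‖I s - (v s).2‖ ≤ 1 / 2 * ‖v s‖ := by
      rw [e2]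
      have := intervalIntegral.norm_integral_le_of_norm_le_const (a := (0 : ℝ)) (b := 1)
        (f := fun u => G s u - (v s).2) (C := 1 / 2 * ‖v s‖) fun u hu =>
          (θ (S s u) - ContinuousLinearMap.snd ℝ P Q).le_of_opNorm_le
            (hsnd _ (hBR (hSmem s hs u (huIoc u hu)))) (v s)
      simpa using this
    have e4 : ‖(v s).2‖ ≤ ‖I s‖ + ‖I s - (v s).2‖ := by
      have := norm_sub_le (I s) (I s - (v s).2)
      simpa using this
    linarith
  -- the growth of `I`, by Stokes' theorem
  have hI' : ∀ s ∈ Ioo (-1 : ℝ) 2, ‖∫ u in (0 : ℝ)..1, G' s u‖ ≤ 2 * (M * K) * ‖I s‖ + 2 * κ :=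
      fun s hs => by
    set D : ℝ → Q := fun u => fderiv ℝ θ (S s u) (v s) (T s u) + θ (S s u) (v' s) with hD
    have hDcont : ContinuousOn D (Icc 0 1) :=
      (((hSD s hs).clm_apply continuousOn_const).clm_apply (hTcont s).continuousOn).add
        ((hSθ s hs).clm_apply continuousOn_const)
    have hcurl : ∀ u, G' s u = curl θ (S s u) (T s u) (v s) + D u := fun u => by
      simp only [hG', hD, curl]; abel
    have hcurlc : ContinuousOn (fun u => curl θ (S s u) (T s u) (v s)) (Icc 0 1) :=
      ((hG'c s hs).sub hDcont).congr fun u _ => by simp [hcurl]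
    have hDint : ∫ u in (0 : ℝ)..1, D u = θ (γ₂ s) (γ₂' s) - θ (γ₁ s) (γ₁' s) := by
      have := intervalIntegral.integral_eq_sub_of_hasDerivAt (a := (0 : ℝ)) (b := 1)
        (f := fun u => θ (S s u) (T s u)) (f' := D) (fun u hu => by
          rw [uIcc_of_le zero_le_one] at hu
          have e1 : HasDerivAt (S s) (v s) u := 
            (((hasDerivAt_id u).smul_const (v s)).const_add (γ₁ s)).congr_deriv (one_smul ℝ _)
          have e2 : HasDerivAt (T s) (v' s) u := 
            (((hasDerivAt_id u).smul_const (v' s)).const_add (γ₁' s)).congr_deriv (one_smul ℝ _)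
          exact ((hdiff _ (hSmem s hs u hu)).comp_hasDerivAt u e1).clm_apply e2) (hInt hDcont)
      rw [this]
      simp [hS, hT, hv, hv']
    have e1 : ∫ u in (0 : ℝ)..1, G' s u = (∫ u in (0 : ℝ)..1, curl θ (S s u) (T s u) (v s))
        + (θ (γ₂ s) (γ₂' s) - θ (γ₁ s) (γ₁' s)) := by
      rw [← hDint, ← intervalIntegral.integral_add (hInt hcurlc) (hInt hDcont)]
      simp only [hcurl]
    have e2 : ‖∫ u in (0 : ℝ)..1, curl θ (S s u) (T s u) (v s)‖ ≤ M * K * ‖v s‖ := by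
      have := intervalIntegral.norm_integral_le_of_norm_le_const (a := (0 : ℝ)) (b := 1)
        (f := fun u => curl θ (S s u) (T s u) (v s)) (C := M * K * ‖v s‖) fun u hu => by
          refine (hM _ (hBR (hSmem s hs u (huIoc u hu))) _ _).trans ?_
          gcongr
          exact hTmem s hs u (huIoc u hu)
      simpa using this
    have e3 : M * K * ‖v s‖ ≤ M * K * (2 * ‖I s‖) := by
      gcongr
      exact hvI s hs
    rw [e1]
    refine (norm_add_le _ _).trans ?_
    have e4 := norm_sub_le (θ (γ₂ s) (γ₂' s)) (θ (γ₁ s) (γ₁' s))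
    linarith [ht1 s hs, ht2 s hs]
  have hsub : ∀ s ∈ Icc (0 : ℝ) 1, s ∈ Ioo (-1 : ℝ) 2 := fun s hs =>
    ⟨by linarith [hs.1], by linarith [hs.2]⟩
  have hfin := norm_le_mul_exp_of_norm_deriv_right_le (f := I)
    (f' := fun s => ∫ u in (0 : ℝ)..1, G' s u) (K := 2 * (M * K)) (ε := 2 * κ)
    (by positivity) (by positivity)
    (fun s hs => (hId s (hsub s hs)).continuousAt.continuousWithinAt)
    (fun s hs => (hId s (hsub s ⟨hs.1, hs.2.le⟩)).hasDerivWithinAt)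
    (by simp [hI, hG, hv, h0])
    (fun s hs => hI' s (hsub s ⟨hs.1, hs.2.le⟩)) 1 (by simp)
  have := hvI 1 (hsub 1 (by simp))
  calc ‖v 1‖ ≤ 2 * (2 * κ * Real.exp (2 * (M * K))) := this.trans (by gcongr)
    _ = _ := by ring

/-- Integral curves of the kernel of `θ` with the same projection to `P` and the same starting
point coincide, if `θ` is the limit of `C¹` forms whose distance `δ` to `θ` beats the exponential
of the size `M` of their exterior derivatives. -/
theorem eq_of_tangent_curves {θ : P × Q → (P × Q →L[ℝ] Q)} {θs : ℕ → P × Q → (P × Q →L[ℝ] Q)}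
    {R ρ c K : ℝ} {τ : ℕ → ℝ} (hρR : ρ < R) (hK0 : 0 ≤ K) (hKc : 2 * K ≤ c)
    (hsnd : ∀ z ∈ Metric.ball (0 : P × Q) R, ‖θ z - ContinuousLinearMap.snd ℝ P Q‖ ≤ 1 / 2)
    (hτ : Tendsto τ atTop (𝓝 0))
    (H : ∀ᶠ k in atTop, ContDiffOn ℝ 1 (θs k) (Metric.ball 0 R) ∧
      (∀ z ∈ Metric.ball (0 : P × Q) R, ‖θs k z - ContinuousLinearMap.snd ℝ P Q‖ ≤ 1 / 2) ∧
      ∃ M δ : ℝ, 0 ≤ M ∧ 0 ≤ δ ∧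
        (∀ z ∈ Metric.ball (0 : P × Q) R, ∀ u w, ‖curl (θs k) z u w‖ ≤ M * ‖u‖ * ‖w‖) ∧
        (∀ z ∈ Metric.ball (0 : P × Q) R, ‖θs k z - θ z‖ ≤ δ) ∧
        δ * Real.exp (c * M) ≤ τ k)
    {γ₁ γ₂ γ₁' γ₂' : ℝ → P × Q}
    (h1 : ∀ s ∈ Ioo (-1 : ℝ) 2, HasDerivAt γ₁ (γ₁' s) s)
    (h2 : ∀ s ∈ Ioo (-1 : ℝ) 2, HasDerivAt γ₂ (γ₂' s) s)
    (hb1 : ∀ s ∈ Ioo (-1 : ℝ) 2, γ₁ s ∈ Metric.closedBall (0 : P × Q) ρ)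
    (hb2 : ∀ s ∈ Ioo (-1 : ℝ) 2, γ₂ s ∈ Metric.closedBall (0 : P × Q) ρ)
    (hfst : ∀ s ∈ Ioo (-1 : ℝ) 2, (γ₁ s).1 = (γ₂ s).1)
    (hK1 : ∀ s ∈ Ioo (-1 : ℝ) 2, ‖(γ₁' s).1‖ ≤ K)
    (ht1 : ∀ s ∈ Ioo (-1 : ℝ) 2, θ (γ₁ s) (γ₁' s) = 0)
    (ht2 : ∀ s ∈ Ioo (-1 : ℝ) 2, θ (γ₂ s) (γ₂' s) = 0)
    (h0 : γ₁ 0 = γ₂ 0) : γ₁ 1 = γ₂ 1 := by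
  have hBR : Metric.closedBall (0 : P × Q) ρ ⊆ Metric.ball 0 R := Metric.closedBall_subset_ball hρR
  have hfst' : ∀ s ∈ Ioo (-1 : ℝ) 2, (γ₁' s).1 = (γ₂' s).1 := fun s hs => by
    have e1 : HasDerivAt (fun s => (γ₁ s).1) (γ₁' s).1 s := (h1 s hs).fst
    have e2 : HasDerivAt (fun s => (γ₂ s).1) (γ₂' s).1 s := (h2 s hs).fst
    refine e1.unique (e2.congr_of_eventuallyEq ?_)
    filter_upwards [isOpen_Ioo.mem_nhds hs] with t ht using hfst t ht
  have hn1 : ∀ s ∈ Ioo (-1 : ℝ) 2, ‖γ₁' s‖ ≤ K := fun s hs => by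
    rw [norm_eq_of_near_snd (hsnd _ (hBR (hb1 s hs))) (ht1 s hs)]
    exact hK1 s hs
  have hn2 : ∀ s ∈ Ioo (-1 : ℝ) 2, ‖γ₂' s‖ ≤ K := fun s hs => by
    rw [norm_eq_of_near_snd (hsnd _ (hBR (hb2 s hs))) (ht2 s hs), ← hfst' s hs]
    exact hK1 s hs
  have key : ∀ᶠ k in atTop, ‖γ₂ 1 - γ₁ 1‖ ≤ 4 * K * τ k := by
    filter_upwards [H] with k hk
    obtain ⟨hC, hs, M, δ, hM0, hδ0, hM, hδ, hMδ⟩ := hk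
    have htan : ∀ z ∈ Metric.closedBall (0 : P × Q) ρ, ∀ w : P × Q, ‖w‖ ≤ K → θ z w = 0 →
        ‖θs k z w‖ ≤ δ * K := fun z hz w hw hzw => by
      have e1 : θs k z w = (θs k z - θ z) w := by simp [hzw]
      rw [e1]
      exact ((θs k z - θ z).le_of_opNorm_le (hδ z (hBR hz)) w).trans (by gcongr)
    have e2 := norm_sub_le_of_almost_tangent hρR hM0 hK0 (mul_nonneg hδ0 hK0) hC hs hM h1 h2 hb1 hb2
      hfst hn1 hn2 (fun s hs => htan _ (hb1 s hs) _ (hn1 s hs) (ht1 s hs))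
      (fun s hs => htan _ (hb2 s hs) _ (hn2 s hs) (ht2 s hs)) h0
    refine e2.trans ?_
    have e3 : Real.exp (2 * (M * K)) ≤ Real.exp (c * M) := Real.exp_le_exp.2 (by nlinarith)
    calc 4 * (δ * K) * Real.exp (2 * (M * K)) ≤ 4 * (δ * K) * Real.exp (c * M) := by gcongr
      _ = 4 * K * (δ * Real.exp (c * M)) := by ring
      _ ≤ _ := by gcongr
  have hlim : Tendsto (fun k => 4 * K * τ k) atTop (𝓝 0) := by simpa using hτ.const_mul (4 * K)
  have := ge_of_tendsto hlim key
  exact (sub_eq_zero.1 (norm_le_zero_iff.1 this)).symm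

end Uniqueness

/-! ### Tuples of one-forms as vector-valued one-forms -/

section Coframe

variable {d n : ℕ}

/-- The `ℝⁿ`-valued linear map `v ↦ (α₁ v, …, αₙ v)` defined by `n` alternating `1`-forms. -/
noncomputable def coframe (d n : ℕ) :
    (Fin n → (Euc d) [⋀^Fin 1]→L[ℝ] ℝ) →L[ℝ] (Euc d →L[ℝ] (Fin n → ℝ)) :=
  LinearMap.mkContinuous
    { toFun := fun α => ContinuousLinearMap.pi fun i =>
        (ContinuousAlternatingMap.ofSubsingleton ℝ (Euc d) ℝ (0 : Fin 1)).symm (α i)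
      map_add' := fun α β => by ext v i; simp
      map_smul' := fun c α => by ext v i; simp } 1 fun α => by
    refine ContinuousLinearMap.opNorm_le_bound _ (by positivity) fun v => ?_
    refine (pi_norm_le_iff_of_nonneg (by positivity)).2 fun i => ?_
    have h1 := (α i).le_opNorm fun _ => v
    simp only [Finset.univ_unique, Finset.prod_const, Finset.card_singleton, pow_one] at h1
    have h2 := norm_le_pi_norm α i
    calc _ ≤ ‖α i‖ * ‖v‖ := h1
      _ ≤ 1 * ‖α‖ * ‖v‖ := by rw [one_mul]; gcongr

@[simp] lemma coframe_apply (α : Fin n → (Euc d) [⋀^Fin 1]→L[ℝ] ℝ) (v : Euc d) (i : Fin n) :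
    coframe d n α v i = α i fun _ => v := rfl

lemma norm_coframe_le {α : Fin n → (Euc d) [⋀^Fin 1]→L[ℝ] ℝ} {C : ℝ} (hC : 0 ≤ C)
    (h : ∀ i, formNorm (α i).toAlternatingMap ≤ C) : ‖coframe d n α‖ ≤ d * C := by
  refine ContinuousLinearMap.opNorm_le_bound _ (by positivity) fun v => ?_
  refine (pi_norm_le_iff_of_nonneg (by positivity)).2 fun i => ?_
  have h1 := abs_apply_le_formNorm (α i).toAlternatingMap fun _ => v
  simp only [Finset.univ_unique, Finset.prod_const, Finset.card_singleton, pow_one] at h1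
  calc _ ≤ (d : ℝ) * formNorm (α i).toAlternatingMap * ‖v‖ := h1
    _ ≤ d * C * ‖v‖ := by gcongr; exact h i

lemma coframe_surjective {α : Fin n → (Euc d) [⋀^Fin 1]→L[ℝ] ℝ} (hα : LinearIndependent ℝ α) :
    Function.Surjective (coframe d n α) := by
  classical
  by_contra hns
  have hlt : LinearMap.range (coframe d n α : Euc d →ₗ[ℝ] Fin n → ℝ) < ⊤ := by
    rw [lt_top_iff_ne_top]
    exact fun h => hns (LinearMap.range_eq_top.1 h)
  obtain ⟨f, hf0, hf⟩ := Submodule.exists_le_ker_of_lt_top _ hlt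
  have hfq : ∀ q : Fin n → ℝ, f q = ∑ i, q i * f (Pi.single i 1) := fun q => by
    conv_lhs => rw [pi_eq_sum_univ' q]
    simp [map_sum]
  have h1 : ∑ i, f (Pi.single i 1) • α i = 0 := by
    ext v
    have hv : v = fun _ => v 0 := by ext1 i; rw [Subsingleton.elim i 0]
    have h2 : f (coframe d n α (v 0)) = 0 := hf ⟨v 0, rfl⟩
    rw [hfq] at h2
    rw [hv]
    simpa [mul_comm] using h2
  have h3 := Fintype.linearIndependent_iff.1 hα _ h1
  refine hf0 (LinearMap.ext fun q => ?_)
  rw [hfq]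
  simp [h3]

lemma curl_coframe_apply {η : Fin n → DiffForm d 1} {x : Euc d}
    (h : ∀ i, DifferentiableAt ℝ (η i) x) (u w : Euc d) (i : Fin n) :
    curl (fun x => coframe d n fun i => η i x) x u w i = extDeriv (η i) x ![u, w] := by
  have h1 : HasFDerivAt (fun x => coframe d n fun i => η i x)
      ((coframe d n).comp (ContinuousLinearMap.pi fun i => fderiv ℝ (η i) x)) x :=
    (coframe d n).hasFDerivAt.comp x (hasFDerivAt_pi.2 fun i => (h i).hasFDerivAt)
  have h2 : ∀ u w : Euc d, fderiv ℝ (fun x => coframe d n fun i => η i x) x u w i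
      = fderiv ℝ (η i) x u fun _ => w := fun u w => by rw [h1.fderiv]; simp
  have h3 : ∀ (u : Euc d) (v : Fin 1 → Euc d),
      fderiv ℝ (fun y => η i y v) x u = fderiv ℝ (η i) x u v := fun u v => by
    have : HasFDerivAt (fun y => η i y v)
        ((ContinuousAlternatingMap.apply ℝ (Euc d) ℝ v).comp (fderiv ℝ (η i) x)) x :=
      (ContinuousAlternatingMap.apply ℝ (Euc d) ℝ v).hasFDerivAt.comp x (h i).hasFDerivAt
    rw [this.fderiv]; rfl
  rw [extDeriv_apply (h i), Fin.sum_univ_two, h3, h3]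
  have e1 : (0 : Fin 2).removeNth ![u, w] = fun _ => w := by
    ext1 j; rw [Subsingleton.elim j 0]; rfl
  have e2 : (1 : Fin 2).removeNth ![u, w] = fun _ => u := by
    ext1 j; rw [Subsingleton.elim j 0]; rfl
  rw [e1, e2]
  simp [curl, h2, sub_eq_add_neg]

end Coframe

/-! ### From suprema with values in `[0, ∞]` to real bounds -/

section Bounds

lemma formNorm_le_toReal {d k : ℕ} {U : Set (Euc d)} {ω : Euc d → (Euc d) [⋀^Fin k]→ₗ[ℝ] ℝ}
    {A : ℝ≥0∞} (hA : A ≠ ∞) (h : formSupNorm U ω ≤ A) {x : Euc d} (hx : x ∈ U) :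
    formNorm (ω x) ≤ A.toReal := by
  rw [← ENNReal.ofReal_le_iff_le_toReal hA]
  exact (le_iSup₂ (f := fun x (_ : x ∈ U) => ENNReal.ofReal (formNorm (ω x))) x hx).trans h

lemma expFactor_of_ne_top {ε : ℝ} (hε : 0 < ε) {S : ℝ≥0∞} (hS : S ≠ ∞) :
    expFactor ε S = ENNReal.ofReal (Real.exp (ε * S.toReal)) := by
  have h1 : ENNReal.ofReal ε * S = ENNReal.ofReal (ε * S.toReal) := by
    rw [ENNReal.ofReal_mul hε.le, ENNReal.ofReal_toReal hS]
  have h2 : ((ENNReal.ofReal (ε * S.toReal) : ℝ≥0∞) : EReal) = ((ε * S.toReal : ℝ) : EReal) := by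
    rw [EReal.coe_ennreal_ofReal, max_eq_left (by positivity)]
  rw [expFactor, h1, h2, EReal.exp_coe]

lemma expFactor_top {ε : ℝ} (hε : 0 < ε) : expFactor ε ∞ = ∞ := by
  rw [expFactor, ENNReal.mul_top (by simpa using hε)]
  simp

/-- A finite product `A exp (ε S)` is a bound by real numbers: either `S` is finite, or `A = 0`, in
which case `S` may be replaced by an arbitrary number `B`. -/
lemma exists_real_exp_bound {ε : ℝ} (hε : 0 < ε) {A S : ℝ≥0∞} (h : A * expFactor ε S ≠ ∞) {B : ℝ}
    (hB : 0 ≤ B) :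
    A ≠ ∞ ∧ ∃ M : ℝ, 0 ≤ M ∧ ((S ≠ ∞ ∧ M = S.toReal) ∨ M = B) ∧
      A.toReal * Real.exp (ε * M) ≤ (A * expFactor ε S).toReal := by
  by_cases hS : S = ∞
  · subst hS
    rw [expFactor_top hε] at h ⊢
    have hA : A = 0 := by
      by_contra hA
      exact h (ENNReal.mul_top hA)
    subst hA
    exact ⟨by simp, B, hB, Or.inr rfl, by simp⟩
  · rw [expFactor_of_ne_top hε hS] at h ⊢
    have hpos : 0 < Real.exp (ε * S.toReal) := Real.exp_pos _
    have hA : A ≠ ∞ := by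
      rintro rfl
      exact h (ENNReal.top_mul (by simpa using hpos))
    refine ⟨hA, S.toReal, ENNReal.toReal_nonneg, Or.inl ⟨hS, rfl⟩, ?_⟩
    rw [ENNReal.toReal_mul, ENNReal.toReal_ofReal hpos.le]

variable {d n : ℕ}

/-- On a compact convex subset of `U`, the exterior derivatives are bounded even if their supremum
over `U` is infinite. -/
lemma exists_curl_bound {U K : Set (Euc d)} (hU : IsOpen U) (hK : IsCompact K) (hc : Convex ℝ K)
    (hKU : K ⊆ U) {η : Fin n → DiffForm d 1} (hη : ∀ i, ContDiffOn ℝ 1 (η i) U) {ε : ℝ}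
    (hε : 0 < ε) {A : ℝ≥0∞} (hfin : A * expFactor ε (⨆ i, supNormD U (η i)) ≠ ∞) :
    A ≠ ∞ ∧ ∃ M : ℝ, 0 ≤ M ∧
      (∀ x ∈ K, ∀ u w, ‖curl (fun x => coframe d n fun i => η i x) x u w‖
        ≤ ((d : ℝ) ^ 2 + 1) * M * ‖u‖ * ‖w‖) ∧
      A.toReal * Real.exp (ε * M) ≤ (A * expFactor ε (⨆ i, supNormD U (η i))).toReal := by
  set Θ : Euc d → (Euc d →L[ℝ] (Fin n → ℝ)) := fun x => coframe d n fun i => η i x with hΘ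
  have hΘC : ContDiffOn ℝ 1 Θ U := (coframe d n).contDiff.comp_contDiffOn (contDiffOn_pi.2 hη)
  obtain ⟨⟨L, hL, hLK⟩, -⟩ := exists_uniform_taylor hU hΘC hK hc hKU
  obtain ⟨hA, M, hM, hM', hAM⟩ := exists_real_exp_bound hε hfin (B := 2 * L) (by positivity)
  refine ⟨hA, M, hM, fun x hx u w => ?_, hAM⟩
  rcases hM' with ⟨hS, rfl⟩ | rfl
  · refine (pi_norm_le_iff_of_nonneg (by positivity)).2 fun i => ?_
    rw [curl_coframe_apply (fun i => ((hη i).differentiableOn one_ne_zero).differentiableAt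
      (hU.mem_nhds (hKU hx)))]
    have h1 := formNorm_le_toReal hS (le_iSup (fun i => supNormD U (η i)) i) (hKU hx)
    have h2 := abs_apply_le_formNorm (extDeriv (η i) x).toAlternatingMap ![u, w]
    have h3 : ∏ j, ‖(![u, w] : Fin 2 → Euc d) j‖ = ‖u‖ * ‖w‖ := by simp [Fin.prod_univ_two]
    calc _ ≤ (d : ℝ) ^ (1 + 1) * formNorm (extDeriv (η i) x).toAlternatingMap * (‖u‖ * ‖w‖) :=
          h3 ▸ h2
      _ ≤ ((d : ℝ) ^ 2 + 1) * (⨆ i, supNormD U (η i)).toReal * (‖u‖ * ‖w‖) := by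
          gcongr
          · exact formNorm_nonneg _
          · norm_num
      _ = _ := by ring
  · have h1 : ∀ u w : Euc d, ‖fderiv ℝ Θ x u w‖ ≤ L * ‖u‖ * ‖w‖ := fun u w => by
      refine (ContinuousLinearMap.le_opNorm₂ _ _ _).trans ?_
      gcongr
      exact hLK x hx
    have h2 : ‖curl Θ x u w‖ ≤ 1 * (2 * L) * ‖u‖ * ‖w‖ := by
      refine (norm_sub_le _ _).trans ?_
      nlinarith [h1 u w, h1 w u]
    refine h2.trans ?_
    gcongr
    nlinarith [sq_nonneg (d : ℝ)]

/-- On the common kernel of the `ηᵢ`, the exterior derivatives are controlled by the forms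
`η₁ ∧ ⋯ ∧ ηₙ ∧ dη_j`. -/
lemma norm_curl_le_of_involutivityDefect {U : Set (Euc d)} {η : Fin n → DiffForm d 1}
    {x : Euc d} (hx : x ∈ U) (h : ∀ i, DifferentiableAt ℝ (η i) x)
    (hA : (⨆ j, involutivityDefect U η j) ≠ ∞) {Y : Fin n → Euc d} {b : ℝ}
    (hY : ∀ j, coframe d n (fun i => η i x) (Y j) = Pi.single j 1) (hYb : ∀ j, ‖Y j‖ ≤ b)
    {u w : Euc d} (hu : coframe d n (fun i => η i x) u = 0)
    (hw : coframe d n (fun i => η i x) w = 0) :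
    ‖curl (fun x => coframe d n fun i => η i x) x u w‖
      ≤ (d : ℝ) ^ (n + 2) * b ^ n * (⨆ j, involutivityDefect U η j).toReal * ‖u‖ * ‖w‖ := by
  have hb : 0 ≤ b ^ n := by
    rcases Nat.eq_zero_or_pos n with rfl | hn
    · simp
    · exact pow_nonneg ((norm_nonneg _).trans (hYb ⟨0, hn⟩)) n
  refine (pi_norm_le_iff_of_nonneg (by positivity)).2 fun j => ?_
  rw [curl_coframe_apply h]
  have h1 := formNorm_le_toReal hA (le_iSup (fun j => involutivityDefect U η j) j) hx
  have h2 := abs_apply_le_formNorm (wedge (wedgeAll n fun i => (η i x).toAlternatingMap)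
    (extDeriv (η j) x).toAlternatingMap) (Fin.append Y ![u, w])
  rw [wedge_wedgeAll_apply] at h2
  · have h3 : ∏ i, ‖(Fin.append Y ![u, w]) i‖ ≤ b ^ n * (‖u‖ * ‖w‖) := by
      rw [Fin.prod_univ_add]
      simp only [Fin.append_left, Fin.append_right]
      have e1 : ∏ i, ‖Y i‖ ≤ b ^ n := by
        calc ∏ i, ‖Y i‖ ≤ ∏ _i : Fin n, b :=
              Finset.prod_le_prod (fun _ _ => norm_nonneg _) fun i _ => hYb i
          _ = b ^ n := by simp
      have e2 : ∏ i : Fin (1 + 1), ‖(![u, w] : Fin 2 → Euc d) i‖ = ‖u‖ * ‖w‖ := by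
        simp [Fin.prod_univ_two]
      rw [e2]
      gcongr
    calc _ ≤ _ := h2
      _ ≤ (d : ℝ) ^ (n + 2) * (⨆ j, involutivityDefect U η j).toReal * (b ^ n * (‖u‖ * ‖w‖)) := by
          gcongr
      _ = _ := by ring
  · intro i j
    have := congrFun (hY j) i
    rw [coframe_apply] at this
    simpa [Pi.single_apply] using this
  · intro i j
    refine Fin.cases ?_ (fun j => ?_) j
    · exact congrFun hu i
    · rw [Subsingleton.elim j 0]
      exact congrFun hw i

end Bounds

/-! ### Charts adapted to the annihilator of a subbundle -/

section Chart

variable {m n : ℕ}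

lemma exists_adapted_equiv (T : Euc (m + n) →L[ℝ] (Fin n → ℝ)) (hT : Function.Surjective T) :
    ∃ Φ : Euc (m + n) ≃L[ℝ] Euc m × (Fin n → ℝ), ∀ v, (Φ v).2 = T v := by
  set K := LinearMap.ker (T : Euc (m + n) →ₗ[ℝ] Fin n → ℝ) with hK
  have hrank : Module.finrank ℝ K = Module.finrank ℝ (Euc m) := by
    have h1 := LinearMap.finrank_range_add_finrank_ker (T : Euc (m + n) →ₗ[ℝ] Fin n → ℝ)
    rw [LinearMap.range_eq_top.2 hT, finrank_top] at h1
    simp only [Module.finrank_fin_fun, finrank_euclideanSpace_fin] at h1 ⊢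
    rw [← hK] at h1
    omega
  obtain ⟨π₀, hπ₀⟩ := K.subtype.exists_leftInverse_of_injective K.ker_subtype
  set e : K ≃ₗ[ℝ] Euc m := LinearEquiv.ofFinrankEq _ _ hrank
  set L : Euc (m + n) →ₗ[ℝ] Euc m × (Fin n → ℝ) :=
    ((e : K →ₗ[ℝ] Euc m).comp π₀).prod (T : Euc (m + n) →ₗ[ℝ] Fin n → ℝ) with hL
  have hinj : Function.Injective L := by
    rw [← LinearMap.ker_eq_bot, LinearMap.ker_eq_bot']
    intro v hv
    have h1 : e (π₀ v) = 0 := congrArg Prod.fst hv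
    have h2 : T v = 0 := congrArg Prod.snd hv
    have h3 : π₀ v = ⟨v, h2⟩ := LinearMap.congr_fun hπ₀ (⟨v, h2⟩ : K)
    rw [e.map_eq_zero_iff, h3] at h1
    exact congrArg Subtype.val h1
  have hdim : Module.finrank ℝ (Euc (m + n)) = Module.finrank ℝ (Euc m × (Fin n → ℝ)) := by simp
  refine ⟨(LinearEquiv.ofInjectiveOfFinrankEq L hinj hdim).toContinuousLinearEquiv, fun v => ?_⟩
  rfl

lemma coframe_apply_eq_zero_iff {U : Set (Euc (m + n))}
    {E : Euc (m + n) → Submodule ℝ (Euc (m + n))} (hE : IsContinuousSubbundle m U E)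
    {η : Fin n → DiffForm (m + n) 1} (hη : IsAnnihilatorBasis U E η) {x : Euc (m + n)} (hx : x ∈ U)
    {v : Euc (m + n)} : coframe (m + n) n (fun i => η i x) v = 0 ↔ v ∈ E x := by
  set T := coframe (m + n) n (fun i => η i x) with hT
  have hsurj : Function.Surjective T := coframe_surjective (hη.2.2 x hx)
  obtain ⟨O, -, hxO, X, -, hX⟩ := hE x hx
  obtain ⟨hXi, hXs⟩ := hX x ⟨hx, hxO⟩
  have hrE : Module.finrank ℝ (E x) = m := by
    rw [← hXs, finrank_span_eq_card hXi, Fintype.card_fin]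
  have hle : E x ≤ LinearMap.ker (T : Euc (m + n) →ₗ[ℝ] Fin n → ℝ) := fun v hv =>
    funext fun i => hη.2.1 i x hx v hv
  have h1 := LinearMap.finrank_range_add_finrank_ker (T : Euc (m + n) →ₗ[ℝ] Fin n → ℝ)
  rw [LinearMap.range_eq_top.2 hsurj, finrank_top] at h1
  simp only [Module.finrank_fin_fun, finrank_euclideanSpace_fin] at h1
  have heq := Submodule.eq_of_le_of_finrank_eq hle (by omega)
  rw [heq]
  rfl

variable {V P Q : Type*} [NormedAddCommGroup V] [NormedSpace ℝ V]
  [NormedAddCommGroup P] [NormedSpace ℝ P] [NormedAddCommGroup Q] [NormedSpace ℝ Q]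

/-- The expression of the `Q`-valued `1`-form `Θ` in the affine coordinates `Φ` centred at `p`. -/
def inChart (Φ : V ≃L[ℝ] P × Q) (p : V) (Θ : V → (V →L[ℝ] Q)) (z : P × Q) : P × Q →L[ℝ] Q :=
  Θ (p + Φ.symm z) ∘L (Φ.symm : P × Q →L[ℝ] V)

@[simp] lemma inChart_apply (Φ : V ≃L[ℝ] P × Q) (p : V) (Θ : V → (V →L[ℝ] Q)) (z u : P × Q) :
    inChart Φ p Θ z u = Θ (p + Φ.symm z) (Φ.symm u) := rfl

lemma curl_inChart {Φ : V ≃L[ℝ] P × Q} {p : V} {Θ : V → (V →L[ℝ] Q)} {z : P × Q}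
    (h : DifferentiableAt ℝ Θ (p + Φ.symm z)) (u w : P × Q) :
    curl (inChart Φ p Θ) z u w = curl Θ (p + Φ.symm z) (Φ.symm u) (Φ.symm w) := by
  have h1 : HasFDerivAt (fun z => Θ (p + Φ.symm z))
      ((fderiv ℝ Θ (p + Φ.symm z)).comp (Φ.symm : P × Q →L[ℝ] V)) z :=
    h.hasFDerivAt.comp z ((Φ.symm : P × Q →L[ℝ] V).hasFDerivAt.const_add p)
  have h2 := h1.clm_comp (hasFDerivAt_const (Φ.symm : P × Q →L[ℝ] V) z)
  have h3 : ∀ u w, fderiv ℝ (inChart Φ p Θ) z u w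
      = fderiv ℝ Θ (p + Φ.symm z) (Φ.symm u) (Φ.symm w) := fun u w => by
    rw [show fderiv ℝ (inChart Φ p Θ) z = _ from h2.fderiv]
    simp
  simp only [curl, h3]

lemma contDiffOn_inChart {Φ : V ≃L[ℝ] P × Q} {p : V} {Θ : V → (V →L[ℝ] Q)} {U : Set V}
    {s : Set (P × Q)} (hΘ : ContDiffOn ℝ 1 Θ U) (hs : ∀ z ∈ s, p + Φ.symm z ∈ U) :
    ContDiffOn ℝ 1 (inChart Φ p Θ) s :=
  (hΘ.comp (f := fun z => p + Φ.symm z)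
    (contDiff_const.add Φ.symm.contDiff).contDiffOn hs).clm_comp contDiffOn_const

lemma continuousOn_inChart {Φ : V ≃L[ℝ] P × Q} {p : V} {Θ : V → (V →L[ℝ] Q)} {U : Set V}
    {s : Set (P × Q)} (hΘ : ContinuousOn Θ U) (hs : ∀ z ∈ s, p + Φ.symm z ∈ U) :
    ContinuousOn (inChart Φ p Θ) s :=
  (hΘ.comp (f := fun z => p + Φ.symm z) (by fun_prop) hs).clm_comp continuousOn_const

lemma norm_inChart_sub_le (Φ : V ≃L[ℝ] P × Q) (p : V) (Θ Θ' : V → (V →L[ℝ] Q)) (z : P × Q) :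
    ‖inChart Φ p Θ z - inChart Φ p Θ' z‖
      ≤ ‖Θ (p + Φ.symm z) - Θ' (p + Φ.symm z)‖ * ‖(Φ.symm : P × Q →L[ℝ] V)‖ := by
  have : inChart Φ p Θ z - inChart Φ p Θ' z
      = (Θ (p + Φ.symm z) - Θ' (p + Φ.symm z)) ∘L (Φ.symm : P × Q →L[ℝ] V) := by
    ext <;> simp
  rw [this]
  exact ContinuousLinearMap.opNorm_comp_le _ _

/-- Around every point there is an affine chart in which a basis of the annihilator becomes close
to the projection to the second factor. -/
lemma exists_adapted_chart {U : Set (Euc (m + n))} (hU : IsOpen U)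
    {E : Euc (m + n) → Submodule ℝ (Euc (m + n))} {η : Fin n → DiffForm (m + n) 1}
    (hη : IsAnnihilatorBasis U E η) {p : Euc (m + n)} (hp : p ∈ U) :
    ∃ (Φ : Euc (m + n) ≃L[ℝ] Euc m × (Fin n → ℝ)) (ρ R : ℝ), 0 < R ∧
      Metric.closedBall p ρ ⊆ U ∧ (∀ v, (Φ v).2 = coframe (m + n) n (fun i => η i p) v) ∧
      ∀ z ∈ Metric.ball (0 : Euc m × (Fin n → ℝ)) R, p + Φ.symm z ∈ Metric.closedBall p ρ ∧
        ‖inChart Φ p (fun x => coframe (m + n) n fun i => η i x) z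
          - ContinuousLinearMap.snd ℝ (Euc m) (Fin n → ℝ)‖ ≤ 1 / 4 := by
  obtain ⟨Φ, hΦ⟩ := exists_adapted_equiv _ (coframe_surjective (hη.2.2 p hp))
  obtain ⟨ρ, hρ, hρU⟩ := Metric.nhds_basis_closedBall.mem_iff.1 (hU.mem_nhds hp)
  have hcoord : ContinuousAt (fun z => p + Φ.symm z) 0 := by fun_prop
  have hp0 : p + Φ.symm 0 = p := by simp
  have hΘ : ContinuousAt (fun x => coframe (m + n) n fun i => η i x) p :=
    (coframe (m + n) n).continuous.continuousAt.comp
      (continuousAt_pi.2 fun i => (hη.1 i).continuousAt (hU.mem_nhds hp))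
  have hc : ContinuousAt (inChart Φ p (fun x => coframe (m + n) n fun i => η i x)) 0 :=
    ContinuousAt.clm_comp (ContinuousAt.comp (g := fun x => coframe (m + n) n fun i => η i x)
      (f := fun z => p + Φ.symm z) (by rwa [hp0]) hcoord)
      continuousAt_const
  have h0 : inChart Φ p (fun x => coframe (m + n) n fun i => η i x) 0
      = ContinuousLinearMap.snd ℝ (Euc m) (Fin n → ℝ) := by
    refine ContinuousLinearMap.ext fun u => ?_
    rw [inChart_apply, hp0, ← hΦ]
    simp
  have e1 : ∀ᶠ z in 𝓝 (0 : Euc m × (Fin n → ℝ)), p + Φ.symm z ∈ Metric.closedBall p ρ :=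
    hcoord (by change _ ∈ 𝓝 (p + Φ.symm 0); rw [hp0]; exact Metric.closedBall_mem_nhds p hρ)
  have e2 := hc (Metric.closedBall_mem_nhds _ (by norm_num : (0 : ℝ) < 1 / 4))
  rw [h0] at e2
  obtain ⟨R, hR, h⟩ := Metric.eventually_nhds_iff_ball.1 (e1.and e2)
  refine ⟨Φ, ρ, R, hR, hρU, hΦ, fun z hz => ⟨(h z hz).1, ?_⟩⟩
  have := (h z hz).2
  rwa [mem_closedBall_iff_norm] at this

lemma norm_coframe_sub_le_of_supDist {d n : ℕ} {U : Set (Euc d)} {α β : Fin n → DiffForm d 1}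
    {x : Euc d} (hx : x ∈ U) (h : (⨆ i, supDist U (α i) (β i)) ≠ ∞) :
    ‖coframe d n (fun i => α i x) - coframe d n (fun i => β i x)‖
      ≤ d * (⨆ i, supDist U (α i) (β i)).toReal := by
  rw [← map_sub]
  exact norm_coframe_le ENNReal.toReal_nonneg fun i =>
    formNorm_le_toReal h (le_iSup (fun i => supDist U (α i) (β i)) i) hx

set_option maxHeartbeats 1000000 in
/-- A strongly asymptotically involutive subbundle has an integral graph through every point. -/
theorem StronglyAsymptoticallyInvolutive.exists_graph {U : Set (Euc (m + n))} (hU : IsOpen U)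
    {E : Euc (m + n) → Submodule ℝ (Euc (m + n))} (hE : IsContinuousSubbundle m U E)
    (h : StronglyAsymptoticallyInvolutive n U E) {p : Euc (m + n)} (hp : p ∈ U) :
    ∃ (Φ : Euc (m + n) ≃L[ℝ] Euc m × (Fin n → ℝ)) (ρ : ℝ) (f : Euc m → (Fin n → ℝ))
      (f' : Euc m → Euc m →L[ℝ] (Fin n → ℝ)), 0 < ρ ∧ f 0 = 0 ∧
      ContinuousOn f' (Metric.ball 0 ρ) ∧
      ∀ x ∈ Metric.ball (0 : Euc m) ρ, HasFDerivAt f (f' x) x ∧ p + Φ.symm (x, f x) ∈ U ∧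
        ∀ v, v ∈ E (p + Φ.symm (x, f x)) ↔ (Φ v).2 = f' x (Φ v).1 := by
  obtain ⟨η, ε₀, ηs, hη, hε₀, hC1, hdist, hinv⟩ := h
  obtain ⟨Φ, ρ₀, R, hR, hρ₀, -, hchart⟩ := exists_adapted_chart hU hη hp
  set b : ℝ := ‖(Φ.symm : Euc m × (Fin n → ℝ) →L[ℝ] Euc (m + n))‖ with hb
  have hb0 : 0 ≤ b := norm_nonneg _
  have hΦb : ∀ u, ‖Φ.symm u‖ ≤ b * ‖u‖ := fun u =>
    (Φ.symm : Euc m × (Fin n → ℝ) →L[ℝ] Euc (m + n)).le_opNorm u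
  set D : ℝ := ((m + n : ℕ) : ℝ) with hD
  have hD0 : 0 ≤ D := Nat.cast_nonneg _
  set C₁ : ℝ := (D ^ 2 + 1) * b ^ 2 with hC₁
  set C₂ : ℝ := D ^ (n + 2) * (2 * b) ^ n * b ^ 2 with hC₂
  have hC₁0 : 0 ≤ C₁ := by positivity
  have hC₂0 : 0 ≤ C₂ := by positivity
  set c : ℝ := ε₀ / (C₁ + 1) with hc
  have hc0 : 0 < c := by positivity
  have hcC : c * C₁ ≤ ε₀ := by
    rw [hc, div_mul_eq_mul_div, div_le_iff₀ (by positivity)]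
    nlinarith
  set ρ : ℝ := min (R / 2) (c / 2) with hρ
  have hρ0 : 0 < ρ := lt_min (by positivity) (by positivity)
  have hρR : ρ < R := (min_le_left _ _).trans_lt (by linarith)
  have hρc : 2 * ρ ≤ c := by have := min_le_right (R / 2) (c / 2); linarith
  set Θ : Euc (m + n) → (Euc (m + n) →L[ℝ] (Fin n → ℝ)) :=
    fun x => coframe (m + n) n fun i => η i x with hΘ
  set Θs : ℕ → Euc (m + n) → (Euc (m + n) →L[ℝ] (Fin n → ℝ)) :=
    fun k x => coframe (m + n) n fun i => ηs k i x with hΘs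
  have hzU : ∀ z ∈ Metric.ball (0 : Euc m × (Fin n → ℝ)) R, p + Φ.symm z ∈ U := fun z hz =>
    hρ₀ (hchart z hz).1
  have hsnd : ∀ z ∈ Metric.ball (0 : Euc m × (Fin n → ℝ)) R,
      ‖inChart Φ p Θ z - ContinuousLinearMap.snd ℝ (Euc m) (Fin n → ℝ)‖ ≤ 1 / 2 := fun z hz =>
    (hchart z hz).2.trans (by norm_num)
  have hΘc : ContinuousOn Θ U :=
    (coframe (m + n) n).continuous.comp_continuousOn (continuousOn_pi.2 hη.1)
  have hθc : ContinuousOn (inChart Φ p Θ) (Metric.ball 0 R) := continuousOn_inChart hΘc hzU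
  have hconv : ∀ ε > 0, ∀ᶠ k in atTop, ∀ z ∈ Metric.ball (0 : Euc m × (Fin n → ℝ)) R,
      ‖inChart Φ p (Θs k) z - inChart Φ p Θ z‖ ≤ ε := by
    intro ε hε
    have hε' : 0 < ε / (D * b + 1) := by positivity
    filter_upwards [hdist.eventually_lt_const (ENNReal.ofReal_pos.2 hε')] with k hk z hz
    have h1 := norm_coframe_sub_le_of_supDist (hzU z hz) (hk.trans ENNReal.ofReal_lt_top).ne
    have h2 : (⨆ i, supDist U (ηs k i) (η i)).toReal ≤ ε / (D * b + 1) :=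
      ENNReal.toReal_le_of_le_ofReal hε'.le hk.le
    refine (norm_inChart_sub_le Φ p _ _ z).trans ?_
    calc _ ≤ (D * (ε / (D * b + 1))) * b := by
          gcongr
          exact h1.trans (by gcongr)
      _ = D * b * ε / (D * b + 1) := by ring
      _ ≤ ε := by
          rw [div_le_iff₀ (by positivity)]
          nlinarith
  set X : ℕ → ℝ≥0∞ := fun k => (⨆ j, involutivityDefect U (ηs k) j) *
    expFactor ε₀ (⨆ i, supNormD U (ηs k i)) with hX
  have hτ : Tendsto (fun k => C₂ * (X k).toReal) atTop (𝓝 0) := by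
    have := ((ENNReal.tendsto_toReal ENNReal.zero_ne_top).comp hinv).const_mul C₂
    simpa using this
  have H : ∀ᶠ k in atTop, IsAlmostInvolutive R c (C₂ * (X k).toReal) (inChart Φ p (Θs k)) := by
    filter_upwards [hinv.eventually_lt_const one_pos, hconv (1 / 4) (by norm_num)] with k hk hk'
    have hfin : X k ≠ ∞ := (hk.trans ENNReal.one_lt_top).ne
    obtain ⟨hA, M, hM0, hM, hAM⟩ := exists_curl_bound hU (isCompact_closedBall p ρ₀)
      (convex_closedBall _ _) hρ₀ (hC1 k) hε₀ hfin
    have hdiff : ∀ x ∈ U, ∀ i, DifferentiableAt ℝ (ηs k i) x := fun x hx i =>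
      ((hC1 k i).differentiableOn one_ne_zero).differentiableAt (hU.mem_nhds hx)
    have hΘsC : ContDiffOn ℝ 1 (Θs k) U :=
      (coframe (m + n) n).contDiff.comp_contDiffOn (contDiffOn_pi.2 (hC1 k))
    have hcurl : ∀ z ∈ Metric.ball (0 : Euc m × (Fin n → ℝ)) R, ∀ u w,
        curl (inChart Φ p (Θs k)) z u w
          = curl (Θs k) (p + Φ.symm z) (Φ.symm u) (Φ.symm w) := fun z hz u w =>
      curl_inChart ((hΘsC.differentiableOn one_ne_zero).differentiableAt
        (hU.mem_nhds (hzU z hz))) u w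
    have hsnd' : ∀ z ∈ Metric.ball (0 : Euc m × (Fin n → ℝ)) R,
        ‖inChart Φ p (Θs k) z - ContinuousLinearMap.snd ℝ (Euc m) (Fin n → ℝ)‖ ≤ 1 / 2 :=
      fun z hz => by
        have h1 := norm_add_le (inChart Φ p (Θs k) z - inChart Φ p Θ z)
          (inChart Φ p Θ z - ContinuousLinearMap.snd ℝ (Euc m) (Fin n → ℝ))
        rw [sub_add_sub_cancel] at h1
        linarith [hk' z hz, (hchart z hz).2]
    refine ⟨contDiffOn_inChart hΘsC hzU, hsnd', C₁ * M,
      C₂ * (⨆ j, involutivityDefect U (ηs k) j).toReal, by positivity, by positivity,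
      fun z hz u w => ?_, fun z hz u w hu hw => ?_, ?_⟩
    · rw [hcurl z hz]
      calc _ ≤ (D ^ 2 + 1) * M * ‖Φ.symm u‖ * ‖Φ.symm w‖ := hM _ (hchart z hz).1 _ _
        _ ≤ (D ^ 2 + 1) * M * (b * ‖u‖) * (b * ‖w‖) := by
            gcongr
            · exact hΦb u
            · exact hΦb w
        _ = _ := by rw [hC₁]; ring
    · rw [hcurl z hz]
      -- vectors dual to the forms, obtained by inverting the form on the second factor
      choose y hy hyb using fun j : Fin n =>
        exists_apply_inr_eq (hsnd' z hz) (Pi.single j (1 : ℝ))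
      have hYb : ∀ j, ‖Φ.symm (0, y j)‖ ≤ 2 * b := fun j => by
        have h4 : ‖(Pi.single j 1 : Fin n → ℝ)‖ = 1 :=
          (Pi.norm_single (G := fun _ : Fin n => ℝ) (i := j) (1 : ℝ)).trans norm_one
        have h5 : ‖((0 : Euc m), y j)‖ = ‖y j‖ := by simp [Prod.norm_def]
        have h6 := hΦb (0, y j)
        have h7 := hyb j
        rw [h5] at h6
        rw [h4] at h7
        nlinarith
      have h2 := norm_curl_le_of_involutivityDefect (η := ηs k) (hzU z hz) (hdiff _ (hzU z hz)) hA
        (Y := fun j => Φ.symm (0, y j)) (b := 2 * b) hy hYb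
        (u := Φ.symm u) (w := Φ.symm w) hu hw
      refine h2.trans ?_
      calc _ ≤ D ^ (n + 2) * (2 * b) ^ n * (⨆ j, involutivityDefect U (ηs k) j).toReal
            * (b * ‖u‖) * (b * ‖w‖) := by
            gcongr
            · exact hΦb u
            · exact hΦb w
        _ = _ := by rw [hC₂]; ring
    · have h1 : Real.exp (c * (C₁ * M)) ≤ Real.exp (ε₀ * M) := Real.exp_le_exp.2 (by nlinarith)
      calc _ ≤ C₂ * (⨆ j, involutivityDefect U (ηs k) j).toReal * Real.exp (ε₀ * M) := by gcongr
        _ = C₂ * ((⨆ j, involutivityDefect U (ηs k) j).toReal * Real.exp (ε₀ * M)) := by ring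
        _ ≤ _ := by gcongr
  obtain ⟨f, hf0, hf⟩ := exists_integral_graph hρ0 hρR hρc hθc hsnd hconv hτ H
  have hfR : ∀ x ∈ Metric.ball (0 : Euc m) ρ,
      (x, f x) ∈ Metric.ball (0 : Euc m × (Fin n → ℝ)) R := fun x hx => by
    rw [mem_ball_zero_iff] at hx ⊢
    exact (norm_prod_le_iff.2 ⟨hx.le, (hf x (by simpa using hx)).1⟩).trans_lt hρR
  refine ⟨Φ, ρ, f, fun x => graphSlope (inChart Φ p Θ (x, f x)), hρ0, hf0, fun x hx => ?_,
    fun x hx => ⟨(hf x hx).2, hzU _ (hfR x hx), fun v => ?_⟩⟩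
  · have h1 : ContinuousAt (fun x => (x, f x)) x :=
      continuousAt_id.prodMk (hf x hx).2.continuousAt
    exact ((contDiffAt_graphSlope (hsnd _ (hfR x hx))).continuousAt.comp
      (f := fun x => inChart Φ p Θ (x, f x)) (ContinuousAt.comp (f := fun x => (x, f x))
        (hθc.continuousAt (Metric.isOpen_ball.mem_nhds (hfR x hx))) h1)).continuousWithinAt
  · rw [← coframe_apply_eq_zero_iff hE hη (hzU _ (hfR x hx))]
    have h1 : coframe (m + n) n (fun i => η i (p + Φ.symm (x, f x))) v
        = inChart Φ p Θ (x, f x) (Φ v) := by simp [hΘ]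
    rw [h1]
    constructor
    · exact fun h => eq_graphSlope_of_apply_eq_zero (hsnd _ (hfR x hx)) h
    · intro h
      have h2 := apply_graphSlope (hsnd _ (hfR x hx)) (Φ v).1
      rwa [← h] at h2

end Chart

/-! ### Integral manifolds -/

section Geometry

variable {m n : ℕ}

lemma isEmbedding_domRestrict_graph (Φ : Euc (m + n) ≃L[ℝ] Euc m × (Fin n → ℝ)) (p : Euc (m + n))
    {f : Euc m → (Fin n → ℝ)} {W : Set (Euc m)} (hf : ContinuousOn f W) :
    Topology.IsEmbedding (W.domRestrict fun x => p + Φ.symm (x, f x)) := by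
  have h1 : ContinuousOn (fun x => p + Φ.symm (x, f x)) W := by fun_prop
  refine Topology.IsEmbedding.of_comp (g := fun q => (Φ (q - p)).1) h1.domRestrict
    (by fun_prop) ?_
  have : (fun q => (Φ (q - p)).1) ∘ W.domRestrict (fun x => p + Φ.symm (x, f x))
      = ((↑) : W → Euc m) := by
    ext1 x
    simp
  rw [this]
  exact Topology.IsEmbedding.subtypeVal

/-- The graph of a `C¹` map whose tangent spaces are the spaces of `E` is an integral manifold. -/
lemma isIntegralManifold_graph {U : Set (Euc (m + n))}
    {E : Euc (m + n) → Submodule ℝ (Euc (m + n))} (Φ : Euc (m + n) ≃L[ℝ] Euc m × (Fin n → ℝ))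
    (p : Euc (m + n)) {f : Euc m → (Fin n → ℝ)} {f' : Euc m → Euc m →L[ℝ] (Fin n → ℝ)}
    {W : Set (Euc m)} (hW : IsOpen W) (hf' : ContinuousOn f' W)
    (h : ∀ x ∈ W, HasFDerivAt f (f' x) x ∧ p + Φ.symm (x, f x) ∈ U ∧
      ∀ v, v ∈ E (p + Φ.symm (x, f x)) ↔ (Φ v).2 = f' x (Φ v).1) :
    IsIntegralManifold m U E ((fun x => p + Φ.symm (x, f x)) '' W) := by
  set φ : Euc m → Euc (m + n) := fun x => p + Φ.symm (x, f x) with hφ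
  have hfC : ContDiffOn ℝ 1 f W := by
    have h1 : ContDiffOn ℝ (0 + 1) f W := by
      refine (contDiffOn_succ_iff_fderiv_of_isOpen hW).2 ⟨fun x hx =>
        (h x hx).1.differentiableAt.differentiableWithinAt, by simp, ?_⟩
      rw [contDiffOn_zero]
      exact hf'.congr fun x hx => (h x hx).1.fderiv
    simpa using h1
  have hφd : ∀ x ∈ W, HasFDerivAt φ ((Φ.symm : Euc m × (Fin n → ℝ) →L[ℝ] Euc (m + n)).comp
      ((ContinuousLinearMap.id ℝ (Euc m)).prod (f' x))) x := fun x hx =>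
    ((Φ.symm : Euc m × (Fin n → ℝ) →L[ℝ] Euc (m + n)).hasFDerivAt.comp x
      ((hasFDerivAt_id x).prodMk (h x hx).1)).const_add p
  have hleft : ∀ x, (Φ (φ x - p)) = (x, f x) := fun x => by simp [hφ]
  have hO : IsOpen {q | (Φ (q - p)).1 ∈ W} := hW.preimage (by fun_prop)
  refine ⟨?_, ?_, ?_⟩
  · rintro _ ⟨x, hx, rfl⟩
    exact (h x hx).2.1
  · rintro _ ⟨x, hx, rfl⟩
    refine ⟨W, φ, {q | (Φ (q - p)).1 ∈ W}, hW, hO, by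
      change (Φ (φ x - p)).1 ∈ W; rwa [hleft], ?_, ?_,
      isEmbedding_domRestrict_graph Φ p hfC.continuousOn, ?_⟩
    · exact contDiffOn_const.add (Φ.symm.contDiff.comp_contDiffOn (contDiffOn_id.prodMk hfC))
    · intro w hw ξ ζ hξ
      rw [(hφd w hw).fderiv] at hξ
      have h1 := Φ.symm.injective hξ
      exact congrArg Prod.fst h1
    · rw [eq_comm, inter_eq_left]
      rintro _ ⟨y, hy, rfl⟩
      change (Φ (φ y - p)).1 ∈ W
      rwa [hleft]
  · rintro _ ⟨x, hx, rfl⟩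
    ext v
    rw [SetLike.mem_coe, (h x hx).2.2 v]
    constructor
    · rintro ⟨γ, hγ0, hγN, hγ⟩
      have h1 : HasDerivAt (fun t => Φ (γ t - p)) (Φ v) 0 :=
        (Φ : Euc (m + n) →L[ℝ] Euc m × (Fin n → ℝ)).hasFDerivAt.comp_hasDerivAt 0 (hγ.sub_const p)
      have hx0 : (Φ (γ 0 - p)).1 = x := by rw [hγ0, hleft]
      have h2 : HasDerivAt (fun t => f (Φ (γ t - p)).1) (f' x (Φ v).1) 0 :=
        HasFDerivAt.comp_hasDerivAt (x := (0 : ℝ)) (f := fun t => (Φ (γ t - p)).1)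
          (by rw [hx0]; exact (h x hx).1) h1.fst
      have h3 : HasDerivAt (fun t => (Φ (γ t - p)).2) (Φ v).2 0 := h1.snd
      refine h3.unique (h2.congr_of_eventuallyEq ?_)
      filter_upwards [hγN] with t ht
      obtain ⟨y, -, hy⟩ := ht
      rw [← hy, hleft]
    · intro hv
      have hline : HasDerivAt (fun t : ℝ => x + t • (Φ v).1) (Φ v).1 0 := by
        simpa using ((hasDerivAt_id (0 : ℝ)).smul_const (Φ v).1).const_add x
      have hx0 : x + (0 : ℝ) • (Φ v).1 = x := by simp
      refine ⟨fun t => φ (x + t • (Φ v).1), by simp, ?_, ?_⟩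
      · have h1 : ContinuousAt (fun t : ℝ => x + t • (Φ v).1) 0 := hline.continuousAt
        have h2 : ∀ᶠ t in 𝓝 (0 : ℝ), x + t • (Φ v).1 ∈ W :=
          h1 (by change W ∈ 𝓝 (x + (0 : ℝ) • (Φ v).1); rw [hx0]; exact hW.mem_nhds hx)
        exact h2.mono fun t ht => ⟨_, ht, rfl⟩
      · have h1 := HasFDerivAt.comp_hasDerivAt (x := (0 : ℝ)) (f := fun t : ℝ => x + t • (Φ v).1)
          (l := φ) (by rw [hx0]; exact hφd x hx) hline
        refine h1.congr_deriv ?_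
        apply Φ.injective
        ext1 <;> simp [hv]

theorem StronglyAsymptoticallyInvolutive.isIntegrable {U : Set (Euc (m + n))} (hU : IsOpen U)
    {E : Euc (m + n) → Submodule ℝ (Euc (m + n))} (hE : IsContinuousSubbundle m U E)
    (h : StronglyAsymptoticallyInvolutive n U E) : IsIntegrable m U E := by
  intro p hp
  obtain ⟨Φ, ρ, f, f', hρ, hf0, hf', hf⟩ := h.exists_graph hU hE hp
  refine ⟨(fun x => p + Φ.symm (x, f x)) '' Metric.ball 0 ρ, ⟨0, by simpa using hρ, ?_⟩,
    isIntegralManifold_graph Φ p Metric.isOpen_ball hf' hf⟩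
  have : ((0 : Euc m), f 0) = 0 := by rw [hf0]; rfl
  change p + Φ.symm (0, f 0) = p
  rw [this, map_zero, add_zero]

lemma IsIntegralManifold.fderiv_parametrization_mem {d : ℕ} {U : Set (Euc d)}
    {E : Euc d → Submodule ℝ (Euc d)} {N : Set (Euc d)} (hN : IsIntegralManifold m U E N)
    {p : Euc d} {W : Set (Euc m)} {φ : Euc m → Euc d} {O : Set (Euc d)}
    (h : IsC1Parametrization N p W φ O) {w : Euc m} (hw : w ∈ W) (ξ : Euc m) :
    fderiv ℝ φ w ξ ∈ E (φ w) := by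
  have hφN : ∀ w ∈ W, φ w ∈ N := fun w hw => (h.image_eq ▸ mem_image_of_mem φ hw : φ w ∈ N ∩ O).1
  rw [← SetLike.mem_coe, ← hN.2.2 _ (hφN w hw)]
  have hline : HasDerivAt (fun t : ℝ => w + t • ξ) ξ 0 := by
    simpa using ((hasDerivAt_id (0 : ℝ)).smul_const ξ).const_add w
  have hw0 : w + (0 : ℝ) • ξ = w := by simp
  refine ⟨fun t => φ (w + t • ξ), by simp, ?_, ?_⟩
  · have h2 : ∀ᶠ t in 𝓝 (0 : ℝ), w + t • ξ ∈ W :=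
      hline.continuousAt (by rw [hw0]; exact h.isOpen_source.mem_nhds hw)
    exact h2.mono fun t ht => hφN _ ht
  · refine HasFDerivAt.comp_hasDerivAt (x := (0 : ℝ)) (f := fun t : ℝ => w + t • ξ) (l := φ) ?_ hline
    rw [hw0]
    exact ((h.contDiffOn.differentiableOn one_ne_zero).differentiableAt
      (h.isOpen_source.mem_nhds hw)).hasFDerivAt

/-- An integral manifold through `p` is locally the image of a section, over the first factor of
an adapted chart; `ψ` recovers the parameter of the point over `x`. -/
lemma IsIntegralManifold.exists_section {U : Set (Euc (m + n))}
    {E : Euc (m + n) → Submodule ℝ (Euc (m + n))} {N : Set (Euc (m + n))}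
    (hN : IsIntegralManifold m U E N) {p : Euc (m + n)} (hp : p ∈ N)
    (Φ : Euc (m + n) ≃L[ℝ] Euc m × (Fin n → ℝ)) (hΦ : ∀ v ∈ E p, (Φ v).2 = 0) {ρ : ℝ}
    (hρ : 0 < ρ) :
    ∃ (σ : Euc m → Euc (m + n)) (σ' : Euc m → Euc m →L[ℝ] Euc (m + n)) (r : ℝ), 0 < r ∧
      σ 0 = p ∧ ∀ x ∈ Metric.ball (0 : Euc m) r, σ x ∈ N ∧ HasFDerivAt σ (σ' x) x ∧
        (∀ ξ, σ' x ξ ∈ E (σ x)) ∧ (Φ (σ x - p)).1 = x ∧ ‖Φ (σ x - p)‖ ≤ ρ := by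
  obtain ⟨W, φ, O, h⟩ := hN.2.1 p hp
  have hφN : ∀ w ∈ W, φ w ∈ N := fun w hw => (h.image_eq ▸ mem_image_of_mem φ hw : φ w ∈ N ∩ O).1
  obtain ⟨w₀, hw₀, hw₀p⟩ : p ∈ φ '' W := by rw [h.image_eq]; exact ⟨hp, h.mem_target⟩
  have hφd : ∀ w ∈ W, HasFDerivAt φ (fderiv ℝ φ w) w := fun w hw =>
    ((h.contDiffOn.differentiableOn one_ne_zero).differentiableAt
      (h.isOpen_source.mem_nhds hw)).hasFDerivAt
  -- the projection of the parametrization to the first factor is a local diffeomorphism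
  set L : Euc (m + n) →L[ℝ] Euc m :=
    (ContinuousLinearMap.fst ℝ (Euc m) (Fin n → ℝ)).comp
      (Φ : Euc (m + n) →L[ℝ] Euc m × (Fin n → ℝ)) with hL
  set g : Euc m → Euc m := fun w => L (φ w - p) with hg
  have hgC : ContDiffAt ℝ 1 g w₀ :=
    L.contDiff.contDiffAt.comp w₀
      ((h.contDiffOn.contDiffAt (h.isOpen_source.mem_nhds hw₀)).sub contDiffAt_const)
  have hgd : HasFDerivAt g (L.comp (fderiv ℝ φ w₀)) w₀ :=
    L.hasFDerivAt.comp w₀ ((hφd w₀ hw₀).sub_const p)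
  have hinj : Function.Injective (L.comp (fderiv ℝ φ w₀) : Euc m →ₗ[ℝ] Euc m) := by
    rw [← LinearMap.ker_eq_bot, LinearMap.ker_eq_bot']
    intro ξ hξ
    have h1 : (Φ (fderiv ℝ φ w₀ ξ)).1 = 0 := hξ
    have h2 : (Φ (fderiv ℝ φ w₀ ξ)).2 = 0 :=
      hΦ _ (hw₀p ▸ hN.fderiv_parametrization_mem h hw₀ ξ)
    have h3 : fderiv ℝ φ w₀ ξ = 0 := Φ.map_eq_zero_iff.1 (Prod.ext h1 h2)
    exact h.immersion w₀ hw₀ (by rw [h3, map_zero])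
  set e : Euc m ≃L[ℝ] Euc m := (LinearEquiv.ofInjectiveEndo _ hinj).toContinuousLinearEquiv with he
  have hge : HasFDerivAt g (e : Euc m →L[ℝ] Euc m) w₀ :=
    hgd.congr_fderiv (ContinuousLinearMap.ext fun _ => rfl)
  have hg0 : g w₀ = 0 := by simp [hg, hw₀p]
  have hstrict := hgC.hasStrictFDerivAt' hge one_ne_zero
  set ψ : Euc m → Euc m := hgC.localInverse hge one_ne_zero with hψ
  have hψ0 : ψ 0 = w₀ := by
    have := hgC.localInverse_apply_image hge one_ne_zero
    rwa [hg0] at this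
  have hψC : ContDiffAt ℝ 1 ψ 0 := by
    have := hgC.to_localInverse hge one_ne_zero
    rwa [hg0] at this
  have hψr : ∀ᶠ x in 𝓝 (0 : Euc m), g (ψ x) = x := by
    have := hstrict.eventually_right_inverse
    rwa [hg0] at this
  have hψW : ∀ᶠ x in 𝓝 (0 : Euc m), ψ x ∈ W :=
    hψC.continuousAt (by rw [hψ0]; exact h.isOpen_source.mem_nhds hw₀)
  have hψd : ∀ᶠ x in 𝓝 (0 : Euc m), DifferentiableAt ℝ ψ x :=
    (hψC.eventually (by simp)).mono fun x hx => hx.differentiableAt one_ne_zero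
  have hσc : ContinuousAt (fun x => Φ (φ (ψ x) - p)) 0 := by
    have h1 : ContinuousAt φ (ψ 0) := by rw [hψ0]; exact (hφd w₀ hw₀).continuousAt
    have h2 : ContinuousAt (fun x => φ (ψ x)) 0 := ContinuousAt.comp (g := φ) h1 hψC.continuousAt
    exact Φ.continuous.continuousAt.comp (h2.sub continuousAt_const)
  have hσρ : ∀ᶠ x in 𝓝 (0 : Euc m), ‖Φ (φ (ψ x) - p)‖ < ρ := by
    have h1 : Tendsto (fun x => ‖Φ (φ (ψ x) - p)‖) (𝓝 0) (𝓝 0) := by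
      have h2 := hσc.norm.tendsto
      rw [hψ0, hw₀p, sub_self, map_zero, norm_zero] at h2
      exact h2
    exact h1.eventually_lt_const hρ
  obtain ⟨r, hr, hball⟩ := Metric.eventually_nhds_iff_ball.1
    (hψr.and (hψW.and (hψd.and hσρ)))
  refine ⟨fun x => φ (ψ x), fun x => (fderiv ℝ φ (ψ x)).comp (fderiv ℝ ψ x), r, hr,
    by change φ (ψ 0) = p; rw [hψ0, hw₀p], fun x hx => ?_⟩
  obtain ⟨h1, h2, h3, h4⟩ := hball x hx
  exact ⟨hφN _ h2, (hφd _ h2).comp x h3.hasFDerivAt,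
    fun ξ => hN.fderiv_parametrization_mem h h2 _, h1, h4.le⟩

/-- Points of an integral manifold `N` close to `p ∈ N` are joined to `p` by arbitrarily short
curves in `N`. -/
lemma IsIntegralManifold.eventually_exists_curve {d : ℕ} {U : Set (Euc d)}
    {E : Euc d → Submodule ℝ (Euc d)} {N : Set (Euc d)} (hN : IsIntegralManifold m U E N)
    {p : Euc d} (hp : p ∈ N) {ε : ℝ} (hε : 0 < ε) :
    ∀ᶠ q in 𝓝 p, q ∈ N → ∃ γ γ' : ℝ → Euc d, γ 0 = p ∧ γ 1 = q ∧
      ∀ s ∈ Ioo (-1 : ℝ) 2, HasDerivAt γ (γ' s) s ∧ γ' s ∈ E (γ s) ∧ ‖γ s - p‖ ≤ ε ∧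
        ‖γ' s‖ ≤ ε := by
  obtain ⟨W, φ, O, h⟩ := hN.2.1 p hp
  obtain ⟨w₀, hw₀, hw₀p⟩ : p ∈ φ '' W := by rw [h.image_eq]; exact ⟨hp, h.mem_target⟩
  have hφd : ∀ w ∈ W, HasFDerivAt φ (fderiv ℝ φ w) w := fun w hw =>
    ((h.contDiffOn.differentiableOn one_ne_zero).differentiableAt
      (h.isOpen_source.mem_nhds hw)).hasFDerivAt
  set B : ℝ := ‖fderiv ℝ φ w₀‖ + 1 with hB
  have hB0 : 0 < B := by positivity
  have hDφ : ∀ᶠ w in 𝓝 w₀, ‖fderiv ℝ φ w‖ < B := by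
    have h1 : ContinuousAt (fderiv ℝ φ) w₀ :=
      (h.contDiffOn.continuousOn_fderiv_of_isOpen h.isOpen_source le_rfl).continuousAt
        (h.isOpen_source.mem_nhds hw₀)
    exact h1.norm.tendsto.eventually_lt_const (by simp [hB])
  have hφε : ∀ᶠ w in 𝓝 w₀, ‖φ w - p‖ < ε := by
    have h1 : Tendsto (fun w => ‖φ w - p‖) (𝓝 w₀) (𝓝 0) := by
      have h2 := ((hφd w₀ hw₀).continuousAt.sub (continuousAt_const (y := p))).norm.tendsto
      simpa [hw₀p] using h2
    exact h1.eventually_lt_const hε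
  have hφW : ∀ᶠ w in 𝓝 w₀, w ∈ W := h.isOpen_source.mem_nhds hw₀
  obtain ⟨r, hr, hball⟩ := Metric.eventually_nhds_iff_ball.1 (hφW.and (hDφ.and hφε))
  set r' : ℝ := min (r / 2) (ε / B) with hr'
  have hr'0 : 0 < r' := lt_min (by positivity) (by positivity)
  -- the parametrization is a homeomorphism onto its image: nearby points have nearby parameters
  have hnear : ∀ᶠ q in 𝓝 p, ∀ w ∈ W, φ w = q → w ∈ Metric.ball w₀ r' := by
    have h1 : ((↑) : W → Euc m) ⁻¹' Metric.ball w₀ r' ∈ 𝓝 (⟨w₀, hw₀⟩ : W) :=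
      continuous_subtype_val.continuousAt (Metric.ball_mem_nhds w₀ hr'0)
    rw [h.isEmbedding.isInducing.nhds_eq_comap, mem_comap] at h1
    obtain ⟨t, ht, htsub⟩ := h1
    have ht' : t ∈ 𝓝 p := by rw [← hw₀p]; exact ht
    filter_upwards [ht'] with q hq w hw hwq
    exact @htsub ⟨w, hw⟩ (by change φ w ∈ t; rwa [hwq])
  filter_upwards [hnear, h.isOpen_target.mem_nhds h.mem_target] with q hq hqO hqN
  obtain ⟨w, hw, hwq⟩ : q ∈ φ '' W := by rw [h.image_eq]; exact ⟨hqN, hqO⟩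
  have hwr : ‖w - w₀‖ < r' := mem_ball_iff_norm.1 (hq w hw hwq)
  have hline : ∀ s : ℝ, HasDerivAt (fun s : ℝ => w₀ + s • (w - w₀)) (w - w₀) s := fun s => by
    simpa using ((hasDerivAt_id s).smul_const (w - w₀)).const_add w₀
  refine ⟨fun s => φ (w₀ + s • (w - w₀)), fun s => fderiv ℝ φ (w₀ + s • (w - w₀)) (w - w₀),
    by simp [hw₀p], by simp [hwq], fun s hs => ?_⟩
  have hmem : w₀ + s • (w - w₀) ∈ Metric.ball w₀ r := by
    rw [mem_ball_iff_norm, add_sub_cancel_left, norm_smul, Real.norm_eq_abs]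
    have h1 : |s| ≤ 2 := abs_le.2 ⟨by linarith [hs.1], hs.2.le⟩
    have h2 : r' ≤ r / 2 := min_le_left _ _
    nlinarith [norm_nonneg (w - w₀), abs_nonneg s]
  obtain ⟨h1, h2, h3⟩ := hball _ hmem
  refine ⟨(hφd _ h1).comp_hasDerivAt s (hline s), hN.fderiv_parametrization_mem h h1 _, h3.le, ?_⟩
  calc _ ≤ ‖fderiv ℝ φ (w₀ + s • (w - w₀))‖ * ‖w - w₀‖ := ContinuousLinearMap.le_opNorm _ _
    _ ≤ B * (ε / B) := by
        gcongr
        exact (hwr.trans_le (min_le_right _ _)).le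
    _ = ε := by field_simp

/-- For a strongly exterior regular subbundle, two integral manifolds through `p` agree near `p`:
a short curve in `N₁` from `p` is projected to the first factor of an adapted chart and lifted to
`N₂`, and the two curves coincide. -/
lemma StronglyExteriorRegular.eventually_mem {U : Set (Euc (m + n))} (hU : IsOpen U)
    {E : Euc (m + n) → Submodule ℝ (Euc (m + n))} (hE : IsContinuousSubbundle m U E)
    (h : StronglyExteriorRegular n U E) {N₁ N₂ : Set (Euc (m + n))}
    (hN₁ : IsIntegralManifold m U E N₁) (hN₂ : IsIntegralManifold m U E N₂) {p : Euc (m + n)}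
    (hp₁ : p ∈ N₁) (hp₂ : p ∈ N₂) : ∀ᶠ q in 𝓝 p, q ∈ N₁ → q ∈ N₂ := by
  have hp : p ∈ U := hN₁.1 hp₁
  obtain ⟨β, ε₁, βs, hβ, hε₁, hC1, hreg⟩ := h
  obtain ⟨Φ, ρ₀, R, hR, hρ₀, hΦp, hchart⟩ := exists_adapted_chart hU hβ hp
  set b : ℝ := ‖(Φ.symm : Euc m × (Fin n → ℝ) →L[ℝ] Euc (m + n))‖ with hb
  have hb0 : 0 ≤ b := norm_nonneg _
  have hΦb : ∀ u, ‖Φ.symm u‖ ≤ b * ‖u‖ := fun u =>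
    (Φ.symm : Euc m × (Fin n → ℝ) →L[ℝ] Euc (m + n)).le_opNorm u
  set a : ℝ := ‖(Φ : Euc (m + n) →L[ℝ] Euc m × (Fin n → ℝ))‖ with ha
  have ha0 : 0 ≤ a := norm_nonneg _
  have hΦa : ∀ u, ‖Φ u‖ ≤ a * ‖u‖ := fun u =>
    (Φ : Euc (m + n) →L[ℝ] Euc m × (Fin n → ℝ)).le_opNorm u
  set D : ℝ := ((m + n : ℕ) : ℝ) with hD
  have hD0 : 0 ≤ D := Nat.cast_nonneg _
  set C₁ : ℝ := (D ^ 2 + 1) * b ^ 2 with hC₁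
  have hC₁0 : 0 ≤ C₁ := by positivity
  set c : ℝ := ε₁ / (C₁ + 1) with hc
  have hc0 : 0 < c := by positivity
  have hcC : c * C₁ ≤ ε₁ := by
    rw [hc, div_mul_eq_mul_div, div_le_iff₀ (by positivity)]
    nlinarith
  set Θ : Euc (m + n) → (Euc (m + n) →L[ℝ] (Fin n → ℝ)) :=
    fun x => coframe (m + n) n fun i => β i x with hΘ
  set Θs : ℕ → Euc (m + n) → (Euc (m + n) →L[ℝ] (Fin n → ℝ)) :=
    fun k x => coframe (m + n) n fun i => βs k i x with hΘs
  have hzU : ∀ z ∈ Metric.ball (0 : Euc m × (Fin n → ℝ)) R, p + Φ.symm z ∈ U := fun z hz =>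
    hρ₀ (hchart z hz).1
  have hsnd : ∀ z ∈ Metric.ball (0 : Euc m × (Fin n → ℝ)) R,
      ‖inChart Φ p Θ z - ContinuousLinearMap.snd ℝ (Euc m) (Fin n → ℝ)‖ ≤ 1 / 2 := fun z hz =>
    (hchart z hz).2.trans (by norm_num)
  set X : ℕ → ℝ≥0∞ := fun k => (⨆ j, supDist U (βs k j) (β j)) *
    expFactor ε₁ (⨆ i, supNormD U (βs k i)) with hX
  have hτ : Tendsto (fun k => D * b * (X k).toReal) atTop (𝓝 0) := by
    have := ((ENNReal.tendsto_toReal ENNReal.zero_ne_top).comp hreg).const_mul (D * b)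
    simpa using this
  have H : ∀ᶠ k in atTop, ContDiffOn ℝ 1 (inChart Φ p (Θs k)) (Metric.ball 0 R) ∧
      (∀ z ∈ Metric.ball (0 : Euc m × (Fin n → ℝ)) R,
        ‖inChart Φ p (Θs k) z - ContinuousLinearMap.snd ℝ (Euc m) (Fin n → ℝ)‖ ≤ 1 / 2) ∧
      ∃ M δ : ℝ, 0 ≤ M ∧ 0 ≤ δ ∧
        (∀ z ∈ Metric.ball (0 : Euc m × (Fin n → ℝ)) R, ∀ u w,
          ‖curl (inChart Φ p (Θs k)) z u w‖ ≤ M * ‖u‖ * ‖w‖) ∧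
        (∀ z ∈ Metric.ball (0 : Euc m × (Fin n → ℝ)) R,
          ‖inChart Φ p (Θs k) z - inChart Φ p Θ z‖ ≤ δ) ∧
        δ * Real.exp (c * M) ≤ D * b * (X k).toReal := by
    filter_upwards [hreg.eventually_lt_const one_pos,
      hτ.eventually_lt_const (by norm_num : (0 : ℝ) < 1 / 4)] with k hk hk'
    have hfin : X k ≠ ∞ := (hk.trans ENNReal.one_lt_top).ne
    obtain ⟨hA, M, hM0, hM, hAM⟩ := exists_curl_bound hU (isCompact_closedBall p ρ₀)
      (convex_closedBall _ _) hρ₀ (hC1 k) hε₁ hfin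
    set δ : ℝ := (⨆ j, supDist U (βs k j) (β j)).toReal with hδ
    have hδ0 : 0 ≤ δ := ENNReal.toReal_nonneg
    have hΘsC : ContDiffOn ℝ 1 (Θs k) U :=
      (coframe (m + n) n).contDiff.comp_contDiffOn (contDiffOn_pi.2 (hC1 k))
    have hdist : ∀ z ∈ Metric.ball (0 : Euc m × (Fin n → ℝ)) R,
        ‖inChart Φ p (Θs k) z - inChart Φ p Θ z‖ ≤ D * b * δ := fun z hz => by
      refine (norm_inChart_sub_le Φ p _ _ z).trans ?_
      calc _ ≤ (D * δ) * b := by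
            gcongr
            exact norm_coframe_sub_le_of_supDist (hzU z hz) hA
        _ = _ := by ring
    have hδX : D * b * (δ * Real.exp (ε₁ * M)) ≤ D * b * (X k).toReal := by gcongr
    have hδ4 : D * b * δ ≤ 1 / 4 := by
      have h1 : 1 ≤ Real.exp (ε₁ * M) := Real.one_le_exp (by positivity)
      have h2 : D * b * δ * 1 ≤ D * b * δ * Real.exp (ε₁ * M) := by gcongr
      linarith
    refine ⟨contDiffOn_inChart hΘsC hzU, fun z hz => ?_, C₁ * M, D * b * δ, by positivity,
      by positivity, fun z hz u w => ?_, hdist, ?_⟩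
    · have h1 := norm_add_le (inChart Φ p (Θs k) z - inChart Φ p Θ z)
        (inChart Φ p Θ z - ContinuousLinearMap.snd ℝ (Euc m) (Fin n → ℝ))
      rw [sub_add_sub_cancel] at h1
      linarith [hdist z hz, (hchart z hz).2]
    · rw [curl_inChart ((hΘsC.differentiableOn one_ne_zero).differentiableAt
        (hU.mem_nhds (hzU z hz)))]
      calc _ ≤ (D ^ 2 + 1) * M * ‖Φ.symm u‖ * ‖Φ.symm w‖ := hM _ (hchart z hz).1 _ _
        _ ≤ (D ^ 2 + 1) * M * (b * ‖u‖) * (b * ‖w‖) := by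
            gcongr
            · exact hΦb u
            · exact hΦb w
        _ = _ := by rw [hC₁]; ring
    · have h1 : Real.exp (c * (C₁ * M)) ≤ Real.exp (ε₁ * M) := Real.exp_le_exp.2 (by nlinarith)
      calc _ ≤ D * b * δ * Real.exp (ε₁ * M) := by gcongr
        _ = D * b * (δ * Real.exp (ε₁ * M)) := by ring
        _ ≤ _ := hδX
  -- a local section of `N₂`
  obtain ⟨σ, σ', r, hr, hσ0, hσ⟩ := hN₂.exists_section hp₂ Φ
    (fun v hv => by rw [hΦp]; exact (coframe_apply_eq_zero_iff hE hβ hp).2 hv)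
    (by positivity : 0 < R / 2)
  -- short curves in `N₁`
  set K : ℝ := min (min (c / 2) (R / 2)) (r / 2) with hK
  have hK0 : 0 < K := lt_min (lt_min (by positivity) (by positivity)) (by positivity)
  have hKc : K ≤ c / 2 := (min_le_left _ _).trans (min_le_left _ _)
  have hKR : K ≤ R / 2 := (min_le_left _ _).trans (min_le_right _ _)
  have hKr : K ≤ r / 2 := min_le_right _ _
  have haK : a * (K / (a + 1)) ≤ K := by
    rw [← mul_div_assoc, div_le_iff₀ (by positivity)]
    nlinarith
  filter_upwards [hN₁.eventually_exists_curve hp₁ (by positivity : 0 < K / (a + 1))] with q hq hqN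
  obtain ⟨γ, γ', hγ0, hγ1, hγ⟩ := hq hqN
  have hΦγ : ∀ s ∈ Ioo (-1 : ℝ) 2, ‖Φ (γ s - p)‖ ≤ K := fun s hs =>
    ((hΦa _).trans (mul_le_mul_of_nonneg_left (hγ s hs).2.2.1 ha0)).trans haK
  have hΦγ' : ∀ s ∈ Ioo (-1 : ℝ) 2, ‖Φ (γ' s)‖ ≤ K := fun s hs =>
    ((hΦa _).trans (mul_le_mul_of_nonneg_left (hγ s hs).2.2.2 ha0)).trans haK
  set x : ℝ → Euc m := fun s => (Φ (γ s - p)).1 with hx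
  have hxr : ∀ s ∈ Ioo (-1 : ℝ) 2, x s ∈ Metric.ball (0 : Euc m) r := fun s hs => by
    rw [mem_ball_zero_iff]
    exact ((norm_fst_le _).trans (hΦγ s hs)).trans_lt (by linarith)
  have hd1 : ∀ s ∈ Ioo (-1 : ℝ) 2, HasDerivAt (fun s => Φ (γ s - p)) (Φ (γ' s)) s := fun s hs =>
    (Φ : Euc (m + n) →L[ℝ] Euc m × (Fin n → ℝ)).hasFDerivAt.comp_hasDerivAt s
      ((hγ s hs).1.sub_const p)
  have hdx : ∀ s ∈ Ioo (-1 : ℝ) 2, HasDerivAt x (Φ (γ' s)).1 s := fun s hs => (hd1 s hs).fst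
  have hd2 : ∀ s ∈ Ioo (-1 : ℝ) 2, HasDerivAt (fun s => Φ (σ (x s) - p))
      (Φ (σ' (x s) (Φ (γ' s)).1)) s := fun s hs =>
    (Φ : Euc (m + n) →L[ℝ] Euc m × (Fin n → ℝ)).hasFDerivAt.comp_hasDerivAt s
      (((hσ _ (hxr s hs)).2.1.comp_hasDerivAt s (hdx s hs)).sub_const p)
  have htan : ∀ y v, y ∈ U → v ∈ E y → inChart Φ p Θ (Φ (y - p)) (Φ v) = 0 := fun y v hy hv => by
    rw [inChart_apply, Φ.symm_apply_apply, Φ.symm_apply_apply, add_sub_cancel]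
    exact (coframe_apply_eq_zero_iff hE hβ hy).2 hv
  have hUof : ∀ y, ‖Φ (y - p)‖ ≤ R / 2 → y ∈ U := fun y hy => by
    have := hzU (Φ (y - p)) (by rw [mem_ball_zero_iff]; linarith)
    simpa using this
  have h01 : ∀ s ∈ Icc (0 : ℝ) 1, s ∈ Ioo (-1 : ℝ) 2 := fun s hs =>
    ⟨by linarith [hs.1], by linarith [hs.2]⟩
  have hγR : ∀ s ∈ Ioo (-1 : ℝ) 2, ‖Φ (γ s - p)‖ ≤ R / 2 := fun s hs => (hΦγ s hs).trans hKR
  have heq := eq_of_tangent_curves (ρ := R / 2) (c := c) (K := K) (by linarith) hK0.le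
    (by linarith) hsnd hτ H hd1 hd2
    (fun s hs => by simpa using hγR s hs)
    (fun s hs => by simpa using (hσ _ (hxr s hs)).2.2.2.2)
    (fun s hs => (hσ _ (hxr s hs)).2.2.2.1.symm)
    (fun s hs => (norm_fst_le _).trans (hΦγ' s hs))
    (fun s hs => htan _ _ (hUof _ (hγR s hs)) (hγ s hs).2.1)
    (fun s hs => htan _ _ (hUof _ (hσ _ (hxr s hs)).2.2.2.2) ((hσ _ (hxr s hs)).2.2.1 _))
    (by simp [hx, hγ0, hσ0])
  have hfin : q = σ (x 1) := by
    have h1 := Φ.injective heq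
    rw [hγ1] at h1
    exact sub_left_injective h1
  rw [hfin]
  exact (hσ _ (hxr 1 (by norm_num))).1

theorem StronglyExteriorRegular.isUniquelyIntegrable {U : Set (Euc (m + n))} (hU : IsOpen U)
    {E : Euc (m + n) → Submodule ℝ (Euc (m + n))} (hE : IsContinuousSubbundle m U E)
    (hint : IsIntegrable m U E) (h : StronglyExteriorRegular n U E) :
    IsUniquelyIntegrable m U E := by
  have key : ∀ N₁ N₂ : Set (Euc (m + n)), IsIntegralManifold m U E N₁ →
      IsIntegralManifold m U E N₂ → IsOpen ((↑) ⁻¹' N₂ : Set N₁) := fun N₁ N₂ h₁ h₂ => by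
    rw [isOpen_iff_mem_nhds]
    intro q hq
    have h1 := continuous_subtype_val.continuousAt.eventually
      (h.eventually_mem hU hE h₁ h₂ q.2 hq)
    filter_upwards [h1] with y hy using hy y.2
  exact ⟨hint, fun N₁ N₂ h₁ h₂ => ⟨key N₁ N₂ h₁ h₂, key N₂ N₁ h₂ h₁⟩⟩

end Geometry

end ContinuousFrobenius


theorem theorem1p9 {m n : ℕ} (c : EuclideanSpace ℝ (Fin (m + n))) (r : ℝ) (hr : 0 < r)
    (E : EuclideanSpace ℝ (Fin (m + n)) → Submodule ℝ (EuclideanSpace ℝ (Fin (m + n))))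
    (hE : ContinuousFrobenius.IsContinuousSubbundle m (Metric.ball c r) E) :
    (ContinuousFrobenius.StronglyAsymptoticallyInvolutive n (Metric.ball c r) E →
      ContinuousFrobenius.IsIntegrable m (Metric.ball c r) E) ∧
    (ContinuousFrobenius.IsIntegrable m (Metric.ball c r) E →
      ContinuousFrobenius.StronglyExteriorRegular n (Metric.ball c r) E →
      ContinuousFrobenius.IsUniquelyIntegrable m (Metric.ball c r) E) :=
  ⟨fun h => h.isIntegrable Metric.isOpen_ball hE,
    fun hint h => h.isUniquelyIntegrable Metric.isOpen_ball hE hint⟩
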